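/- **Setting.** Let $\mathrm{Var}_1,\mathrm{Var}_2$ be finite sets of variables and $\mathrm{Val}$ a countable set of values; $S_i=(\mathrm{Var}_i\to \mathrm{Val})$ is the set of states. pWhile commands over $\mathrm{Var}_i$ are $$c ::= \mathsf{skip}\mid x:=e\mid x\xleftarrow{\$} d\mid c;c'\mid \mathsf{if}\ b\ \mathsf{then}\ c\ \mathsf{else}\ c'\mid \mathsf{while}\ b\ \mathsf{do}\ c,$$ where $e$, $d$, $b$ are functions from states to values, to probability distributions on $\mathrm{Val}$, and to booleans. The semantics $[\![c]\!]_\sigma$ of $c$ on a state $\sigma$ is the usual sub-distribution over final states; in particular, writing $r_b$ for the restriction to states satisfying $b$, $[\![\mathsf{while}\ b\ \mathsf{do}\ c]\!]=\sum_{n\ge 0} r_{\neg b}\circ([\![c]\!]\circ r_b)^n$. It extends linearly to sub-distributions. The command $c$ is AST if $[\![c]\!]_\sigma$ has total mass $1$ for every state $\sigma$. Assertions are functions $\psi:S_1\times S_2\to[0,\infty]$ (arbitrary: neither bounded nor finite-valued), and $\mathbb E_\mu[\psi]=\sum\mu\cdot\psi$ with $0\cdot\infty=0$. A coupling of two sub-distributions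 $\mu_1,\mu_2$ is a sub-distribution on the product with marginals $\mu_1$ and $\mu_2$. A judgment $\{\psi\}\,c_1\sim c_2\,\{\phi\}$ is *valid* if for every sub-distribution $\mu$ on $S_1\times S_2$, with marginals $\mu_1,\mu_2$, there is a coupling $\nu$ of $[\![c_1]\!](\mu_1)$ and $[\![c_2]\!](\mu_2)$ with $\mathbb E_\nu[\phi]\le\mathbb E_\mu[\psi]$. It is *$\star$-valid* if for all $\sigma_1,\sigma_2$ there is a coupling $\nu$ of the distributions on $S_i\cup\{\star\}$ obtained from $[\![c_i]\!]_{\sigma_i}$ by putting the missing mass on $\star$, with $\mathbb E_\nu[\phi]\le\psi(\sigma_1,\sigma_2)$, where $\phi$ is extended by $0$ to pairs with a component $\star$. **Proof system.** Write $P\mid\psi$ for the assertion equal to $\psi$ where $P$ holds and to $\infty$ elsewhere. Commands are identified up to the congruence generated by $\mathsf{skip};c\equiv c\equiv c;\mathsf{skip}$. Derivability $\vdash$ is generated by the following rules (a one-sided rule, and NMod, also has its mirror image). - Skip: $\vdash\{\psi\}\,\mathsf{skip}\sim\mathsf{skip}\,\{\psi\}$. - Assign: $\vdash\{\psi[e_1/x_1,e_2/x_2]\}\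 x_1:=e_1\sim x_2:=e_2\ \{\psi\}$. Assign-L: $\vdash\{\psi[e_1/x_1]\}\ x_1:=e_1\sim\mathsf{skip}\ \{\psi\}$. - Seq: from $\{\psi\}\,c_1\sim c_2\,\{\xi\}$ and $\{\xi\}\,c_1'\sim c_2'\,\{\phi\}$ infer $\{\psi\}\,c_1;c_1'\sim c_2;c_2'\,\{\phi\}$. - If: from $\{b_1\wedge b_2\mid\psi\}\,c_1\sim c_2\,\{\phi\}$ and $\{\neg b_1\wedge\neg b_2\mid\psi\}\,c_1'\sim c_2'\,\{\phi\}$ infer $\{b_1\leftrightarrow b_2\mid\psi\}\ \mathsf{if}\ b_1\ \mathsf{then}\ c_1\ \mathsf{else}\ c_1'\sim\mathsf{if}\ b_2\ \mathsf{then}\ c_2\ \mathsf{else}\ c_2'\ \{\phi\}$. If-L: from $\{b_1\mid\psi\}\,c_1\sim c_2\,\{\phi\}$ and $\{\neg b_1\mid\psi\}\,c_1'\sim c_2\,\{\phi\}$ infer $\{\psi\}\ \mathsf{if}\ b_1\ \mathsf{then}\ c_1\ \mathsf{else}\ c_1'\sim c_2\ \{\phi\}$. - While: from $\{b_1\wedge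 b_2\mid\psi\}\,c_1\sim c_2\,\{b_1\leftrightarrow b_2\mid\psi\}$ infer $\{b_1\leftrightarrow b_2\mid\psi\}\ \mathsf{while}\ b_1\ \mathsf{do}\ c_1\sim\mathsf{while}\ b_2\ \mathsf{do}\ c_2\ \{\neg b_1\wedge\neg b_2\mid\psi\}$. While-L: from $\{b_1\mid\psi\}\,c_1\sim\mathsf{skip}\,\{\psi\}$ infer $\{\psi\}\ \mathsf{while}\ b_1\ \mathsf{do}\ c_1\sim\mathsf{skip}\ \{\neg b_1\mid\psi\}$. - Sample: if for all $\sigma_1,\sigma_2$ there is a coupling $\nu$ of $d_1(\sigma_1)$ and $d_2(\sigma_2)$ with $\mathbb E_{(v,w)\sim\nu}[\phi(\sigma_1[v/x_1],\sigma_2[w/x_2])]\le\psi(\sigma_1,\sigma_2)$, infer $\{\psi\}\ x_1\xleftarrow{\$}d_1\sim x_2\xleftarrow{\$}d_2\ \{\phi\}$. Sample-L: $\vdash\{\mathbb E_{v\sim d_1}[\psi[v/x_1]]\}\ x_1\xleftarrow{\$}d_1\sim\mathsf{skip}\ \{\psi\}$. - Conseq: from $\{\psi'\}\,c_1\sim c_2\,\{\phi'\}$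 infer $\{\psi\}\,c_1\sim c_2\,\{\phi\}$, provided that for all sub-distributions $\mu$ on $S_1\times S_2$ and $\mu_i$ on $S_i$, $\mathbb E_\mu[\psi']\ge\inf_\nu\mathbb E_\nu[\phi']$ implies $\mathbb E_\mu[\psi]\ge\inf_\nu\mathbb E_\nu[\phi]$, where $\nu$ ranges over the couplings of $\mu_1$ and $\mu_2$ ($\inf\emptyset=\infty$). - NMod: if $x_1$ is neither assigned nor sampled in $c_1$, from $\{x_1=v\mid\psi\}\,c_1\sim c_2\,\{\phi[v/x_1]\}$ for all $v$ infer $\{\psi\}\,c_1\sim c_2\,\{\phi\}$. - Unbounded-Duality: if $c_1,c_2$ are AST, from $\{\psi+n\}\,c_1\sim c_2\,\{\phi_1\otimes \mathit{id}+\mathit{id}\otimes\phi_2\}$ for all $(n,\phi_1,\phi_2)\in\mathcal Y(\phi)$ infer $\{\psi\}\,c_1\sim c_2\,\{\phi\}$. Here $(\phi_1\otimes\mathit{id}+\mathit{id}\otimes\phi_2)(\sigma_1,\sigma_2)=\phi_1(\sigma_1)+\phi_2(\sigma_2)$, and $\mathcal Y(\phi)$ is the set of triples with $n\in\mathbb N$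 and bounded $\phi_i:S_i\to[0,\infty)$ such that $\phi_1\otimes\mathit{id}+\mathit{id}\otimes\phi_2\le\phi+n$ pointwise. **Proposition (soundness and completeness of eRHL with unbounded duality).** Let $c_1,c_2$ be AST pWhile programs. For all assertions $\psi,\phi:S_1\times S_2\to[0,\infty]$, the following are equivalent: (i) $\vdash\{\psi\}\,c_1\sim c_2\,\{\phi\}$; (ii) $\{\psi\}\,c_1\sim c_2\,\{\phi\}$ is $\star$-valid; (iii) $\{\psi\}\,c_1\sim c_2\,\{\phi\}$ is valid. Moreover, if every loop occurring in $c_1$ and $c_2$ is AST, then for all such $\psi,\phi$ the judgment is valid if and only if it is derivable using While-L and While-R only for AST loops. -/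

import Mathlib

open scoped ENNReal NNReal

namespace ERHL

/-! ## Discrete sub-distributions, expectations, couplings -/

/-- A mass function on `A` is a sub-distribution if its total mass is at most one. -/
def IsSubDist {A : Type*} (μ : A → ℝ≥0∞) : Prop := ∑' a, μ a ≤ 1

/-- Expected value of `φ`, with the convention `0 * ∞ = 0`. -/
noncomputable def expect {A : Type*} (μ : A → ℝ≥0∞) (φ : A → ℝ≥0∞) : ℝ≥0∞ :=
  ∑' a, μ a * φ a

/-- First marginal of a joint mass function. -/
noncomputable def margL {A B : Type*} (μ : A × B → ℝ≥0∞) : A → ℝ≥0∞ :=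
  fun a => ∑' b, μ (a, b)

/-- Second marginal of a joint mass function. -/
noncomputable def margR {A B : Type*} (μ : A × B → ℝ≥0∞) : B → ℝ≥0∞ :=
  fun b => ∑' a, μ (a, b)

/-- `μ` is a coupling of `μ₁` and `μ₂`. -/
def IsCoupling {A B : Type*} (μ : A × B → ℝ≥0∞) (μ₁ : A → ℝ≥0∞) (μ₂ : B → ℝ≥0∞) : Prop :=
  margL μ = μ₁ ∧ margR μ = μ₂

/-- The infimum of the expectation of `φ` over all couplings of `μ₁` and `μ₂`
(which is `∞` if there is no coupling). -/
noncomputable def couplingInf {A B : Type*} (μ₁ : A → ℝ≥0∞) (μ₂ : B → ℝ≥0∞)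
    (φ : A × B → ℝ≥0∞) : ℝ≥0∞ :=
  ⨅ (μ : A × B → ℝ≥0∞) (_ : IsCoupling μ μ₁ μ₂), expect μ φ

/-- Completion of a sub-distribution to a distribution on `A ∪ {⋆}` (`⋆` is `none`):
the missing mass is put on `⋆`. -/
noncomputable def star {A : Type*} (μ : A → ℝ≥0∞) : Option A → ℝ≥0∞
  | none => 1 - ∑' a, μ a
  | some a => μ a

/-- Extension of a relational expectation by `0` to pairs with a component `⋆`. -/
def starExt {A B : Type*} (φ : A × B → ℝ≥0∞) : Option A × Option B → ℝ≥0∞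
  | (some a, some b) => φ (a, b)
  | _ => 0

/-! ## The language pWhile -/

/-- Program states: memories mapping variables to values. -/
abbrev State (Var Val : Type*) := Var → Val

/-- Commands of pWhile. Expressions, guards and distribution expressions are given by their
interpretations as functions of the current state. -/
inductive Cmd (Var Val : Type*) where
  | skip : Cmd Var Val
  | assign (x : Var) (e : State Var Val → Val) : Cmd Var Val
  | sample (x : Var) (d : State Var Val → PMF Val) : Cmd Var Val
  | seq (c c' : Cmd Var Val) : Cmd Var Val
  | cond (b : State Var Val → Bool) (c c' : Cmd Var Val) : Cmd Var Val
  | loop (b : State Var Val → Bool) (c : Cmd Var Val) : Cmd Var Val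

/-- Image of a mass function under a transition kernel. -/
noncomputable def push {A B : Type*} (k : A → B → ℝ≥0∞) (μ : A → ℝ≥0∞) : B → ℝ≥0∞ :=
  fun b => ∑' a, μ a * k a b

/-- Restriction of a mass function to the states where `b` holds. -/
def restrict {A : Type*} (b : A → Bool) (μ : A → ℝ≥0∞) : A → ℝ≥0∞ :=
  fun a => if b a then μ a else 0

/-- Denotational semantics: `sem c σ τ` is the probability that `c`, started in `σ`,
terminates in `τ`. -/
noncomputable def sem {Var Val : Type*} [DecidableEq Var] :
    Cmd Var Val → State Var Val → State Var Val → ℝ≥0∞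
  | .skip, σ => ⇑(PMF.pure σ)
  | .assign x e, σ => ⇑(PMF.pure (Function.update σ x (e σ)))
  | .sample x d, σ => ⇑((d σ).map fun v => Function.update σ x v)
  | .seq c c', σ => push (sem c') (sem c σ)
  | .cond b c c', σ => if b σ then sem c σ else sem c' σ
  | .loop b c, σ => fun τ =>
      ∑' n : ℕ, restrict (fun a => !b a)
        ((fun μ => push (sem c) (restrict b μ))^[n] ⇑(PMF.pure σ)) τ

/-- Output sub-distribution of `c` on an input sub-distribution. -/
noncomputable def run {Var Val : Type*} [DecidableEq Var] (c : Cmd Var Val)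
    (μ : State Var Val → ℝ≥0∞) : State Var Val → ℝ≥0∞ :=
  push (sem c) μ

/-- Almost sure termination: from every initial state, `c` terminates with probability one. -/
def AST {Var Val : Type*} [DecidableEq Var] (c : Cmd Var Val) : Prop :=
  ∀ σ, ∑' τ, sem c σ τ = 1

/-- Every loop that occurs in the command is almost surely terminating. -/
def HAST {Var Val : Type*} [DecidableEq Var] : Cmd Var Val → Prop
  | .skip => True
  | .assign _ _ => True
  | .sample _ _ => True
  | .seq c c' => HAST c ∧ HAST c'
  | .cond _ c c' => HAST c ∧ HAST c'
  | .loop b c => HAST c ∧ AST (.loop b c)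

/-- The variables that are assigned or sampled in a command. -/
def modVars {Var Val : Type*} : Cmd Var Val → Set Var
  | .skip => ∅
  | .assign x _ => {x}
  | .sample x _ => {x}
  | .seq c c' => modVars c ∪ modVars c'
  | .cond _ c c' => modVars c ∪ modVars c'
  | .loop _ c => modVars c

/-- Commands are identified up to `skip; c ≡ c ≡ c; skip`: this is the least congruence with
these two laws. -/
inductive SkipEquiv {Var Val : Type*} : Cmd Var Val → Cmd Var Val → Prop
  | refl (c) : SkipEquiv c c
  | symm {c d} : SkipEquiv c d → SkipEquiv d c
  | trans {c d e} : SkipEquiv c d → SkipEquiv d e → SkipEquiv c e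
  | skip_seq (c) : SkipEquiv (.seq .skip c) c
  | seq_skip (c) : SkipEquiv (.seq c .skip) c
  | seq {c c' d d'} : SkipEquiv c d → SkipEquiv c' d' → SkipEquiv (.seq c c') (.seq d d')
  | cond (b) {c c' d d'} :
      SkipEquiv c d → SkipEquiv c' d' → SkipEquiv (.cond b c c') (.cond b d d')
  | loop (b) {c d} : SkipEquiv c d → SkipEquiv (.loop b c) (.loop b d)

/-! ## Relational assertions and judgments -/

/-- Relational pre-expectations: pairs of states are mapped to extended non-negative reals. -/
abbrev Assn (Var₁ Var₂ Val : Type*) := State Var₁ Val × State Var₂ Val → ℝ≥0∞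

open Classical in
/-- The guarded assertion `P ∣ ψ`: it is `ψ` where `P` holds, and `∞` elsewhere. -/
noncomputable def guard {A : Type*} (P : A → Prop) (ψ : A → ℝ≥0∞) : A → ℝ≥0∞ :=
  fun a => if P a then ψ a else ∞

/-- A bounded non-negative assertion. -/
def IsBdd {A : Type*} (φ : A → ℝ≥0∞) : Prop := ∃ L : ℝ≥0, ∀ a, φ a ≤ L

/-- The split assertion `φ₁ ⊗ id + id ⊗ φ₂`. -/
def split {A B : Type*} (φ₁ : A → ℝ≥0∞) (φ₂ : B → ℝ≥0∞) : A × B → ℝ≥0∞ :=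
  fun p => φ₁ p.1 + φ₂ p.2

/-- The duality set of `φ`: triples `(n, φ₁, φ₂)` with `φ₁`, `φ₂` bounded and
`φ₁ ⊗ id + id ⊗ φ₂ ≤ φ + n`. -/
def dualitySet {A B : Type*} (φ : A × B → ℝ≥0∞) :
    Set (ℕ × (A → ℝ≥0∞) × (B → ℝ≥0∞)) :=
  {t | IsBdd t.2.1 ∧ IsBdd t.2.2 ∧ ∀ p, split t.2.1 t.2.2 p ≤ φ p + (t.1 : ℝ≥0∞)}

section Logic

variable {Var₁ Var₂ Val : Type*} [DecidableEq Var₁] [DecidableEq Var₂]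

/-- Validity of a judgment `{ψ} c₁ ∼ c₂ {φ}` through couplings of the two outputs. -/
def Valid (ψ : Assn Var₁ Var₂ Val) (c₁ : Cmd Var₁ Val) (c₂ : Cmd Var₂ Val)
    (φ : Assn Var₁ Var₂ Val) : Prop :=
  ∀ μ : State Var₁ Val × State Var₂ Val → ℝ≥0∞, IsSubDist μ →
    ∃ ν : State Var₁ Val × State Var₂ Val → ℝ≥0∞,
      IsSubDist ν ∧ IsCoupling ν (run c₁ (margL μ)) (run c₂ (margR μ)) ∧
        expect ν φ ≤ expect μ ψ

/-- Validity of a judgment `{ψ} c₁ ∼ c₂ {φ}` through `⋆`-couplings, that is, couplings of the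
completed outputs. -/
def StarValid (ψ : Assn Var₁ Var₂ Val) (c₁ : Cmd Var₁ Val) (c₂ : Cmd Var₂ Val)
    (φ : Assn Var₁ Var₂ Val) : Prop :=
  ∀ (σ₁ : State Var₁ Val) (σ₂ : State Var₂ Val),
    ∃ ν : Option (State Var₁ Val) × Option (State Var₂ Val) → ℝ≥0∞,
      IsCoupling ν (star (sem c₁ σ₁)) (star (sem c₂ σ₂)) ∧
        expect ν (starExt φ) ≤ ψ (σ₁, σ₂)

/-- Derivability of judgments `{ψ} c₁ ∼ c₂ {φ}` in eRHL extended with the rule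
`unboundedDuality`. If `strict` holds, then the one-sided loop rules carry the additional side
condition that the loop is almost surely terminating; eRHL is the case `strict = False`. -/
inductive Derivable (strict : Prop) :
    Assn Var₁ Var₂ Val → Cmd Var₁ Val → Cmd Var₂ Val → Assn Var₁ Var₂ Val → Prop
  /- Two-sided rules -/
  | skip (ψ) : Derivable strict ψ .skip .skip ψ
  | assign (ψ) (x₁ : Var₁) (e₁ : State Var₁ Val → Val) (x₂ : Var₂)
      (e₂ : State Var₂ Val → Val) :
      Derivable strict
        (fun p => ψ (Function.update p.1 x₁ (e₁ p.1), Function.update p.2 x₂ (e₂ p.2)))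
        (.assign x₁ e₁) (.assign x₂ e₂) ψ
  | seq {ψ ξ φ c₁ c₁' c₂ c₂'} :
      Derivable strict ψ c₁ c₂ ξ → Derivable strict ξ c₁' c₂' φ →
      Derivable strict ψ (.seq c₁ c₁') (.seq c₂ c₂') φ
  | cond {ψ φ c₁ c₁' c₂ c₂'} (b₁ : State Var₁ Val → Bool) (b₂ : State Var₂ Val → Bool) :
      Derivable strict (guard (fun p => b₁ p.1 = true ∧ b₂ p.2 = true) ψ) c₁ c₂ φ →
      Derivable strict (guard (fun p => b₁ p.1 = false ∧ b₂ p.2 = false) ψ) c₁' c₂' φ →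
      Derivable strict (guard (fun p => b₁ p.1 = b₂ p.2) ψ)
        (.cond b₁ c₁ c₁') (.cond b₂ c₂ c₂') φ
  | loop {ψ c₁ c₂} (b₁ : State Var₁ Val → Bool) (b₂ : State Var₂ Val → Bool) :
      Derivable strict (guard (fun p => b₁ p.1 = true ∧ b₂ p.2 = true) ψ) c₁ c₂
        (guard (fun p => b₁ p.1 = b₂ p.2) ψ) →
      Derivable strict (guard (fun p => b₁ p.1 = b₂ p.2) ψ)
        (.loop b₁ c₁) (.loop b₂ c₂)
        (guard (fun p => b₁ p.1 = false ∧ b₂ p.2 = false) ψ)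
  | sample {ψ φ} (x₁ : Var₁) (d₁ : State Var₁ Val → PMF Val) (x₂ : Var₂)
      (d₂ : State Var₂ Val → PMF Val) :
      (∀ σ₁ σ₂, ∃ ν : Val × Val → ℝ≥0∞, IsCoupling ν ⇑(d₁ σ₁) ⇑(d₂ σ₂) ∧
        expect ν (fun v => φ (Function.update σ₁ x₁ v.1, Function.update σ₂ x₂ v.2))
          ≤ ψ (σ₁, σ₂)) →
      Derivable strict ψ (.sample x₁ d₁) (.sample x₂ d₂) φ
  /- One-sided rules -/
  | assignL (ψ) (x₁ : Var₁) (e₁ : State Var₁ Val → Val) :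
      Derivable strict (fun p => ψ (Function.update p.1 x₁ (e₁ p.1), p.2))
        (.assign x₁ e₁) .skip ψ
  | assignR (ψ) (x₂ : Var₂) (e₂ : State Var₂ Val → Val) :
      Derivable strict (fun p => ψ (p.1, Function.update p.2 x₂ (e₂ p.2)))
        .skip (.assign x₂ e₂) ψ
  | sampleL (ψ) (x₁ : Var₁) (d₁ : State Var₁ Val → PMF Val) :
      Derivable strict
        (fun p => expect ⇑(d₁ p.1) (fun v => ψ (Function.update p.1 x₁ v, p.2)))
        (.sample x₁ d₁) .skip ψ
  | sampleR (ψ) (x₂ : Var₂) (d₂ : State Var₂ Val → PMF Val) :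
      Derivable strict
        (fun p => expect ⇑(d₂ p.2) (fun v => ψ (p.1, Function.update p.2 x₂ v)))
        .skip (.sample x₂ d₂) ψ
  | condL {ψ φ c₁ c₁' c₂} (b₁ : State Var₁ Val → Bool) :
      Derivable strict (guard (fun p => b₁ p.1 = true) ψ) c₁ c₂ φ →
      Derivable strict (guard (fun p => b₁ p.1 = false) ψ) c₁' c₂ φ →
      Derivable strict ψ (.cond b₁ c₁ c₁') c₂ φ
  | condR {ψ φ c₁ c₂ c₂'} (b₂ : State Var₂ Val → Bool) :
      Derivable strict (guard (fun p => b₂ p.2 = true) ψ) c₁ c₂ φ →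
      Derivable strict (guard (fun p => b₂ p.2 = false) ψ) c₁ c₂' φ →
      Derivable strict ψ c₁ (.cond b₂ c₂ c₂') φ
  | loopL {ψ c₁} (b₁ : State Var₁ Val → Bool) :
      (strict → AST (.loop b₁ c₁)) →
      Derivable strict (guard (fun p => b₁ p.1 = true) ψ) c₁ .skip ψ →
      Derivable strict ψ (.loop b₁ c₁) .skip (guard (fun p => b₁ p.1 = false) ψ)
  | loopR {ψ c₂} (b₂ : State Var₂ Val → Bool) :
      (strict → AST (.loop b₂ c₂)) →
      Derivable strict (guard (fun p => b₂ p.2 = true) ψ) .skip c₂ ψ →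
      Derivable strict ψ .skip (.loop b₂ c₂) (guard (fun p => b₂ p.2 = false) ψ)
  /- Structural rules -/
  | skipEquiv {ψ φ c₁ c₁' c₂ c₂'} :
      SkipEquiv c₁ c₁' → SkipEquiv c₂ c₂' →
      Derivable strict ψ c₁ c₂ φ → Derivable strict ψ c₁' c₂' φ
  | conseq {ψ ψ' φ φ' c₁ c₂} :
      Derivable strict ψ' c₁ c₂ φ' →
      (∀ (μ : State Var₁ Val × State Var₂ Val → ℝ≥0∞)
        (μ₁ : State Var₁ Val → ℝ≥0∞) (μ₂ : State Var₂ Val → ℝ≥0∞),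
        IsSubDist μ → IsSubDist μ₁ → IsSubDist μ₂ →
        couplingInf μ₁ μ₂ φ' ≤ expect μ ψ' → couplingInf μ₁ μ₂ φ ≤ expect μ ψ) →
      Derivable strict ψ c₁ c₂ φ
  | nmodL {ψ φ c₁ c₂} (x₁ : Var₁) :
      x₁ ∉ modVars c₁ →
      (∀ v : Val, Derivable strict (guard (fun p => p.1 x₁ = v) ψ) c₁ c₂
        (fun p => φ (Function.update p.1 x₁ v, p.2))) →
      Derivable strict ψ c₁ c₂ φ
  | nmodR {ψ φ c₁ c₂} (x₂ : Var₂) :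
      x₂ ∉ modVars c₂ →
      (∀ v : Val, Derivable strict (guard (fun p => p.2 x₂ = v) ψ) c₁ c₂
        (fun p => φ (p.1, Function.update p.2 x₂ v))) →
      Derivable strict ψ c₁ c₂ φ
  | unboundedDuality {ψ φ c₁ c₂} :
      AST c₁ → AST c₂ →
      (∀ (n : ℕ) (φ₁ : State Var₁ Val → ℝ≥0∞) (φ₂ : State Var₂ Val → ℝ≥0∞),
        (n, φ₁, φ₂) ∈ dualitySet φ →
        Derivable strict (fun p => ψ p + (n : ℝ≥0∞)) c₁ c₂ (split φ₁ φ₂)) →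
      Derivable strict ψ c₁ c₂ φ

end Logic

end ERHL

/-!
Soundness: every rule preserves `⋆`-validity. For a loop, the finite unrollings are related by
`⋆`-couplings, and a `⋆`-coupling of the limits is extracted from them by compactness, since the
expectation of a fixed cost is lower semicontinuous in the coupling and no mass escapes. The
unbounded duality rule is Kantorovich duality for costs with values in `[0, ∞]`: for finite costs
on finite sets it is Sion's minimax theorem for the Lagrangian that penalizes wrong marginals; for
costs factoring through finite quotients the optimal coupling lifts along conditional
distributions; a general cost is the supremum of such costs, and compactness of the set of
couplings allows passing to the limit.

Completeness: the one-sided rules derive the weakest pre-expectation of a command. As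
`c₁ ≡ c₁; skip` and `c₂ ≡ skip; c₂`, running `c₁` first and `c₂` afterwards derives the exact
pre-expectation of a bounded split post-expectation, and these are the only premises of the
unbounded duality rule. For almost surely terminating commands, `⋆`-couplings of the outputs are
the same as couplings.
-/

namespace ERHL

section Expectation

variable {A B C : Type*}

theorem expect_le_expect {μ φ φ' : A → ℝ≥0∞} (h : ∀ a, μ a ≠ 0 → φ a ≤ φ' a) :
    expect μ φ ≤ expect μ φ' := by
  refine ENNReal.tsum_le_tsum fun a => ?_
  by_cases ha : μ a = 0
  · simp [ha]
  · exact mul_le_mul_right (h a ha) (μ a)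

theorem expect_congr {μ φ φ' : A → ℝ≥0∞} (h : ∀ a, μ a ≠ 0 → φ a = φ' a) :
    expect μ φ = expect μ φ' :=
  (expect_le_expect fun a ha => (h a ha).le).antisymm (expect_le_expect fun a ha => (h a ha).ge)

theorem expect_mono {μ μ' φ φ' : A → ℝ≥0∞} (hμ : μ ≤ μ') (hφ : φ ≤ φ') :
    expect μ φ ≤ expect μ' φ' :=
  ENNReal.tsum_le_tsum fun a => mul_le_mul' (hμ a) (hφ a)

theorem expect_one (μ : A → ℝ≥0∞) : expect μ (fun _ => 1) = ∑' a, μ a := by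
  simp only [expect, mul_one]

theorem expect_const (μ : A → ℝ≥0∞) (r : ℝ≥0∞) : expect μ (fun _ => r) = (∑' a, μ a) * r :=
  ENNReal.tsum_mul_right

theorem expect_add (μ φ φ' : A → ℝ≥0∞) :
    expect μ (fun a => φ a + φ' a) = expect μ φ + expect μ φ' := by
  simp only [expect, mul_add, ENNReal.tsum_add]

theorem expect_pure (a : A) (φ : A → ℝ≥0∞) : expect ⇑(PMF.pure a) φ = φ a := by
  classical
  rw [expect, tsum_eq_single a fun b hb => by simp [PMF.pure_apply, hb]]
  simp

theorem tsum_iSup_of_monotone {f : ℕ → A → ℝ≥0∞} (hf : Monotone f) :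
    ∑' a, ⨆ n, f n a = ⨆ n, ∑' a, f n a := by
  simp only [ENNReal.tsum_eq_iSup_sum]
  rw [iSup_comm]
  exact iSup_congr fun s =>
    ENNReal.finsetSum_iSup_of_monotone fun a _ _ hmn => hf hmn a

theorem expect_iSup_of_monotone (μ : A → ℝ≥0∞) {φ : ℕ → A → ℝ≥0∞} (hφ : Monotone φ) :
    expect μ (fun a => ⨆ n, φ n a) = ⨆ n, expect μ (φ n) := by
  simp only [expect, ENNReal.mul_iSup]
  exact tsum_iSup_of_monotone fun m n hmn a => mul_le_mul_right (hφ hmn a) (μ a)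

theorem expect_push (k : A → B → ℝ≥0∞) (μ : A → ℝ≥0∞) (φ : B → ℝ≥0∞) :
    expect (push k μ) φ = expect μ fun a => expect (k a) φ := by
  simp only [expect, push, ← ENNReal.tsum_mul_right, ← ENNReal.tsum_mul_left, mul_assoc]
  exact ENNReal.tsum_comm

theorem tsum_push (k : A → B → ℝ≥0∞) (μ : A → ℝ≥0∞) :
    ∑' b, push k μ b = expect μ fun a => ∑' b, k a b := by
  simp only [← expect_one, expect_push]

theorem push_push (l : B → C → ℝ≥0∞) (k : A → B → ℝ≥0∞) (μ : A → ℝ≥0∞) :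
    push l (push k μ) = push (fun a => push l (k a)) μ :=
  funext fun c => expect_push k μ fun b => l b c

theorem push_pure (k : A → B → ℝ≥0∞) (a : A) : push k ⇑(PMF.pure a) = k a :=
  funext fun b => expect_pure a fun a => k a b

theorem push_pure_kernel (μ : A → ℝ≥0∞) : push (fun a => ⇑(PMF.pure a)) μ = μ := by
  classical
  funext b
  rw [push, tsum_eq_single b fun a ha => by simp [PMF.pure_apply, ha.symm]]
  simp

theorem push_zero (k : A → B → ℝ≥0∞) : push k 0 = 0 := by
  funext b
  simp [push]

theorem push_congr {k k' : A → B → ℝ≥0∞} {μ : A → ℝ≥0∞} (h : ∀ a, μ a ≠ 0 → k a = k' a) :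
    push k μ = push k' μ :=
  funext fun b => expect_congr fun a ha => congrFun (h a ha) b

theorem push_mono {k k' : A → B → ℝ≥0∞} {μ μ' : A → ℝ≥0∞} (hk : k ≤ k') (hμ : μ ≤ μ') :
    push k μ ≤ push k' μ' :=
  fun b => expect_mono hμ fun a => hk a b

theorem exists_ne_zero_of_push_ne_zero {k : A → B → ℝ≥0∞} {μ : A → ℝ≥0∞} {b : B}
    (h : push k μ b ≠ 0) : ∃ a, μ a ≠ 0 ∧ k a b ≠ 0 := by
  contrapose! h
  exact ENNReal.tsum_eq_zero.2 fun a => mul_eq_zero.2 (or_iff_not_imp_left.2 (h a))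

theorem restrict_push (p : B → Bool) (k : A → B → ℝ≥0∞) (μ : A → ℝ≥0∞) :
    restrict p (push k μ) = push (fun a => restrict p (k a)) μ := by
  funext b
  by_cases h : p b = true <;> simp [restrict, push, h]

theorem restrict_pure (p : A → Bool) (a : A) :
    restrict p ⇑(PMF.pure a) = if p a then ⇑(PMF.pure a) else 0 := by
  classical
  funext b
  obtain rfl | hab := eq_or_ne b a
  · by_cases h : p b = true <;> simp [restrict, h]
  · by_cases h : p a = true <;> simp [restrict, h, PMF.pure_apply, hab]

theorem eq_of_pure_ne_zero {a b : A} (h : (PMF.pure a) b ≠ 0) : b = a := by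
  simpa using (PMF.mem_support_iff _ _).2 h

theorem isSubDist_pmf (p : PMF A) : IsSubDist ⇑p := p.tsum_coe.le

theorem IsSubDist.mono {μ μ' : A → ℝ≥0∞} (h : IsSubDist μ') (hle : μ ≤ μ') : IsSubDist μ :=
  (ENNReal.tsum_le_tsum hle).trans h

theorem IsSubDist.push {μ : A → ℝ≥0∞} (hμ : IsSubDist μ) {k : A → B → ℝ≥0∞}
    (hk : ∀ a, IsSubDist (k a)) : IsSubDist (push k μ) :=
  calc ∑' b, ERHL.push k μ b = expect μ fun a => ∑' b, k a b := tsum_push k μ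
    _ ≤ expect μ fun _ => 1 := expect_mono le_rfl hk
    _ ≤ 1 := (expect_one μ).trans_le hμ

end Expectation

section Marginals

variable {A B A' B' : Type*}

theorem expect_margL (μ : A × B → ℝ≥0∞) (φ : A → ℝ≥0∞) :
    expect (margL μ) φ = expect μ fun p => φ p.1 := by
  simp only [expect, margL, ENNReal.tsum_prod', ENNReal.tsum_mul_right]

theorem expect_swap (μ φ : A × B → ℝ≥0∞) :
    expect (μ ∘ Prod.swap) (φ ∘ Prod.swap) = expect μ φ :=
  (Equiv.prodComm B A).tsum_eq fun p => μ p * φ p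

theorem expect_margR (μ : A × B → ℝ≥0∞) (φ : B → ℝ≥0∞) :
    expect (margR μ) φ = expect μ fun p => φ p.2 :=
  (expect_margL (μ ∘ Prod.swap) φ).trans (expect_swap μ fun p => φ p.2)

theorem tsum_margL (μ : A × B → ℝ≥0∞) : ∑' a, margL μ a = ∑' p, μ p := by
  rw [← expect_one, ← expect_one, expect_margL]

theorem tsum_margR (μ : A × B → ℝ≥0∞) : ∑' b, margR μ b = ∑' p, μ p := by
  rw [← expect_one, ← expect_one, expect_margR]

theorem le_margL (μ : A × B → ℝ≥0∞) (p : A × B) : μ p ≤ margL μ p.1 :=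
  ENNReal.le_tsum (f := fun b => μ (p.1, b)) p.2

theorem le_margR (μ : A × B → ℝ≥0∞) (p : A × B) : μ p ≤ margR μ p.2 :=
  ENNReal.le_tsum (f := fun a => μ (a, p.2)) p.1

theorem margL_push (k : A → A' × B' → ℝ≥0∞) (μ : A → ℝ≥0∞) :
    margL (push k μ) = push (fun a => margL (k a)) μ := by
  funext a
  simp only [margL, push, ← ENNReal.tsum_mul_left]
  exact ENNReal.tsum_comm

theorem margR_push (k : A → A' × B' → ℝ≥0∞) (μ : A → ℝ≥0∞) :
    margR (push k μ) = push (fun a => margR (k a)) μ :=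
  margL_push (fun a => k a ∘ Prod.swap) μ

theorem push_margL (k : A → A' → ℝ≥0∞) (μ : A × B → ℝ≥0∞) :
    push k (margL μ) = push (fun p => k p.1) μ :=
  funext fun a => expect_margL μ fun x => k x a

theorem push_margR (k : B → B' → ℝ≥0∞) (μ : A × B → ℝ≥0∞) :
    push k (margR μ) = push (fun p => k p.2) μ :=
  funext fun a => expect_margR μ fun x => k x a

theorem margL_pure (p : A × B) : margL ⇑(PMF.pure p) = ⇑(PMF.pure p.1) := by
  rw [← push_pure_kernel (margL _), push_margL, push_pure]

theorem margR_pure (p : A × B) : margR ⇑(PMF.pure p) = ⇑(PMF.pure p.2) := by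
  rw [← push_pure_kernel (margR _), push_margR, push_pure]

/-- The product of two mass functions, that is, their independent coupling when both have
total mass one. -/
noncomputable def prodMass (μ₁ : A → ℝ≥0∞) (μ₂ : B → ℝ≥0∞) : A × B → ℝ≥0∞ :=
  fun p => μ₁ p.1 * μ₂ p.2

theorem margL_prodMass (μ₁ : A → ℝ≥0∞) (μ₂ : B → ℝ≥0∞) :
    margL (prodMass μ₁ μ₂) = fun a => μ₁ a * ∑' b, μ₂ b :=
  funext fun a => by simp only [margL, prodMass, ENNReal.tsum_mul_left]

theorem margR_prodMass (μ₁ : A → ℝ≥0∞) (μ₂ : B → ℝ≥0∞) :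
    margR (prodMass μ₁ μ₂) = fun b => (∑' a, μ₁ a) * μ₂ b :=
  funext fun b => by simp only [margR, prodMass, ENNReal.tsum_mul_right]

theorem expect_prodMass (μ₁ : A → ℝ≥0∞) (μ₂ : B → ℝ≥0∞) (φ : A × B → ℝ≥0∞) :
    expect (prodMass μ₁ μ₂) φ = expect μ₁ fun a => expect μ₂ fun b => φ (a, b) := by
  simp only [expect, prodMass, ENNReal.tsum_prod', mul_assoc, ENNReal.tsum_mul_left]

theorem isCoupling_prodMass {μ₁ : A → ℝ≥0∞} {μ₂ : B → ℝ≥0∞} (h₁ : ∑' a, μ₁ a = 1)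
    (h₂ : ∑' b, μ₂ b = 1) : IsCoupling (prodMass μ₁ μ₂) μ₁ μ₂ := by
  simp only [IsCoupling, margL_prodMass, margR_prodMass, h₁, h₂, one_mul, mul_one, and_self]

theorem IsCoupling.tsum_left {ν : A × B → ℝ≥0∞} {μ₁ : A → ℝ≥0∞} {μ₂ : B → ℝ≥0∞}
    (h : IsCoupling ν μ₁ μ₂) : ∑' a, μ₁ a = ∑' p, ν p :=
  h.1 ▸ tsum_margL ν

theorem IsCoupling.tsum_right {ν : A × B → ℝ≥0∞} {μ₁ : A → ℝ≥0∞} {μ₂ : B → ℝ≥0∞}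
    (h : IsCoupling ν μ₁ μ₂) : ∑' b, μ₂ b = ∑' p, ν p :=
  h.2 ▸ tsum_margR ν

theorem IsCoupling.push {ν : A × B → ℝ≥0∞} {μ₁ : A → ℝ≥0∞} {μ₂ : B → ℝ≥0∞}
    {κ : A × B → A' × B' → ℝ≥0∞} {k₁ : A → A' → ℝ≥0∞} {k₂ : B → B' → ℝ≥0∞}
    (hν : IsCoupling ν μ₁ μ₂) (hκ : ∀ p, ν p ≠ 0 → IsCoupling (κ p) (k₁ p.1) (k₂ p.2)) :
    IsCoupling (push κ ν) (push k₁ μ₁) (push k₂ μ₂) := by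
  obtain ⟨rfl, rfl⟩ := hν
  rw [push_margL, push_margR]
  exact ⟨(margL_push κ ν).trans (push_congr fun p hp => (hκ p hp).1),
    (margR_push κ ν).trans (push_congr fun p hp => (hκ p hp).2)⟩

theorem IsCoupling.expect_split {ν : A × B → ℝ≥0∞} {μ₁ : A → ℝ≥0∞} {μ₂ : B → ℝ≥0∞}
    (h : IsCoupling ν μ₁ μ₂) (φ₁ : A → ℝ≥0∞) (φ₂ : B → ℝ≥0∞) :
    expect ν (split φ₁ φ₂) = expect μ₁ φ₁ + expect μ₂ φ₂ := by
  rw [← h.1, ← h.2, expect_margL, expect_margR, ← expect_add]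
  rfl

end Marginals

section Loops

variable {A C : Type*}

/-- The part of the output of `while b do k`, for a transition kernel `k`, that comes from the
runs leaving the loop after exactly `n` iterations. -/
noncomputable def loopExit (b : A → Bool) (k : A → A → ℝ≥0∞) (n : ℕ) (μ : A → ℝ≥0∞) :
    A → ℝ≥0∞ :=
  restrict (fun a => !b a) ((fun μ => push k (restrict b μ))^[n] μ)

/-- The part of the output of `while b do k`, for a transition kernel `k`, that comes from the
runs leaving the loop after fewer than `n` iterations. -/
noncomputable def loopApprox (b : A → Bool) (k : A → A → ℝ≥0∞) : ℕ → A → A → ℝ≥0∞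
  | 0, _ => 0
  | n + 1, a => if b a then push (loopApprox b k n) (k a) else ⇑(PMF.pure a)

variable (b : A → Bool) (k : A → A → ℝ≥0∞)

theorem loopExit_eq_push (n : ℕ) (μ : A → ℝ≥0∞) :
    loopExit b k n μ = push (fun a => loopExit b k n ⇑(PMF.pure a)) μ := by
  have restrict_eq (p : A → Bool) (μ : A → ℝ≥0∞) :
      restrict p μ = push (fun a => restrict p ⇑(PMF.pure a)) μ := by
    rw [← restrict_push, push_pure_kernel]
  induction n generalizing μ with
  | zero => exact restrict_eq _ μ
  | succ n ih =>
    calc loopExit b k n (push k (restrict b μ))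
        = push (fun a => loopExit b k n ⇑(PMF.pure a)) (push k (restrict b μ)) := ih _
      _ = push (fun a => push (fun a => loopExit b k n ⇑(PMF.pure a))
            (push k (restrict b ⇑(PMF.pure a)))) μ := by
          rw [restrict_eq b μ, push_push, push_push]
          simp only [push_push]
      _ = push (fun a => loopExit b k (n + 1) ⇑(PMF.pure a)) μ := by
          simp only [← ih]
          rfl

theorem loopExit_zero_pure (a : A) :
    loopExit b k 0 ⇑(PMF.pure a) = if b a then 0 else ⇑(PMF.pure a) := by
  rw [loopExit, Function.iterate_zero, id_eq, restrict_pure]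
  cases b a <;> rfl

theorem loopExit_succ_pure (n : ℕ) (a : A) :
    loopExit b k (n + 1) ⇑(PMF.pure a) =
      if b a then push (fun x => loopExit b k n ⇑(PMF.pure x)) (k a) else 0 := by
  rw [← loopExit_eq_push]
  change loopExit b k n (push k (restrict b ⇑(PMF.pure a))) = _
  rw [restrict_pure]
  cases b a
  · rw [loopExit_eq_push]
    simp [push_zero]
  · simp [push_pure]

theorem sum_loopExit_pure (n : ℕ) (a : A) :
    ∑ i ∈ Finset.range n, loopExit b k i ⇑(PMF.pure a) = loopApprox b k n a := by
  induction n generalizing a with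
  | zero => rfl
  | succ n ih =>
    rw [Finset.sum_range_succ', loopApprox]
    simp only [loopExit_succ_pure, loopExit_zero_pure]
    cases b a
    · simp
    · simp only [↓reduceIte, add_zero]
      funext x
      simp only [Finset.sum_apply, push, ← ih, Finset.mul_sum]
      exact (Summable.tsum_finsetSum fun _ _ => ENNReal.summable).symm

theorem loopApprox_mono : Monotone (loopApprox b k) := by
  refine monotone_nat_of_le_succ fun n => ?_
  induction n with
  | zero => exact fun _ _ => zero_le
  | succ n ih =>
    intro a
    rw [loopApprox, loopApprox]
    split_ifs
    · exact push_mono ih le_rfl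
    · exact le_rfl

variable {b k}

theorem isSubDist_loopApprox (hk : ∀ a, IsSubDist (k a)) (n : ℕ) (a : A) :
    IsSubDist (loopApprox b k n a) := by
  induction n generalizing a with
  | zero => simp [loopApprox, IsSubDist]
  | succ n ih =>
    rw [loopApprox]
    split_ifs
    · exact (hk a).push ih
    · exact isSubDist_pmf _

theorem apply_eq_of_loopApprox_ne_zero {f : A → C} (hk : ∀ a a', k a a' ≠ 0 → f a' = f a)
    {n : ℕ} {a a' : A} (h : loopApprox b k n a a' ≠ 0) : f a' = f a := by
  induction n generalizing a with
  | zero => exact absurd rfl h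
  | succ n ih =>
    rw [loopApprox] at h
    split_ifs at h
    · obtain ⟨x, hax, hxa'⟩ := exists_ne_zero_of_push_ne_zero h
      exact (ih hxa').trans (hk a x hax)
    · rw [eq_of_pure_ne_zero h]

end Loops

section Semantics

variable {Var Val : Type*} [DecidableEq Var]

theorem sem_sample (x : Var) (d : State Var Val → PMF Val) (σ : State Var Val) :
    sem (.sample x d) σ = push (fun v => ⇑(PMF.pure (Function.update σ x v))) ⇑(d σ) := by
  funext τ
  simp only [sem, push, ← PMF.bind_pure_comp, PMF.bind_apply, Function.comp_apply]

theorem sem_loop (b : State Var Val → Bool) (c : Cmd Var Val) (σ : State Var Val) :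
    sem (.loop b c) σ = ⨆ n, loopApprox b (sem c) n σ := by
  funext τ
  rw [iSup_apply]
  simp only [← sum_loopExit_pure, Finset.sum_apply]
  exact ENNReal.tsum_eq_iSup_nat

theorem sem_loop_unfold (b : State Var Val → Bool) (c : Cmd Var Val) (σ : State Var Val) :
    sem (.loop b c) σ =
      if b σ then push (sem (.loop b c)) (sem c σ) else ⇑(PMF.pure σ) := by
  have mono : Monotone (loopApprox b (sem c)) := loopApprox_mono b _
  rw [sem_loop, ← Monotone.iSup_nat_add (fun _ _ hmn => mono hmn σ) 1]
  simp only [loopApprox]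
  split_ifs
  · funext τ
    simp only [iSup_apply, push, sem_loop]
    exact (expect_iSup_of_monotone (sem c σ) fun _ _ hmn ρ => mono hmn ρ τ).symm
  · exact iSup_const

theorem isSubDist_sem (c : Cmd Var Val) (σ : State Var Val) : IsSubDist (sem c σ) := by
  induction c generalizing σ with
  | skip | assign | sample => exact isSubDist_pmf _
  | seq c c' ih ih' => exact (ih σ).push ih'
  | cond b c c' ih ih' =>
    rw [sem]
    split_ifs
    exacts [ih σ, ih' σ]
  | loop b c ih =>
    simp only [IsSubDist, sem_loop, iSup_apply]
    rw [tsum_iSup_of_monotone fun _ _ hmn => loopApprox_mono b _ hmn σ]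
    exact iSup_le fun n => isSubDist_loopApprox ih n σ

theorem apply_eq_of_sem_ne_zero {x : Var} {c : Cmd Var Val} (hx : x ∉ modVars c)
    {σ τ : State Var Val} (h : sem c σ τ ≠ 0) : τ x = σ x := by
  induction c generalizing σ τ with
  | skip => rw [eq_of_pure_ne_zero h]
  | assign y e => rw [eq_of_pure_ne_zero h, Function.update_of_ne hx]
  | sample y d =>
    rw [sem_sample] at h
    obtain ⟨v, -, hv⟩ := exists_ne_zero_of_push_ne_zero h
    rw [eq_of_pure_ne_zero hv, Function.update_of_ne hx]
  | seq c c' ih ih' =>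
    obtain ⟨hx, hx'⟩ := not_or.1 hx
    obtain ⟨ρ, hσρ, hρτ⟩ := exists_ne_zero_of_push_ne_zero h
    exact (ih' hx' hρτ).trans (ih hx hσρ)
  | cond b c c' ih ih' =>
    obtain ⟨hx, hx'⟩ := not_or.1 hx
    rw [sem] at h
    split_ifs at h
    exacts [ih hx h, ih' hx' h]
  | loop b c ih =>
    rw [sem_loop, iSup_apply, ← bot_eq_zero, Ne, iSup_eq_bot, not_forall] at h
    obtain ⟨n, hn⟩ := h
    exact apply_eq_of_loopApprox_ne_zero (f := fun σ => σ x) (fun _ _ => ih hx) hn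

theorem SkipEquiv.sem_eq {c d : Cmd Var Val} (h : SkipEquiv c d) : sem c = sem d := by
  induction h with
  | refl => rfl
  | symm _ ih => exact ih.symm
  | trans _ _ ih ih' => exact ih.trans ih'
  | skip_seq c => exact funext fun σ => push_pure _ σ
  | seq_skip c => exact funext fun σ => push_pure_kernel _
  | seq _ _ ih ih' | cond _ _ _ ih ih' =>
    funext σ
    simp only [sem, ih, ih']
  | loop _ _ ih =>
    funext σ
    simp only [sem, ih]

theorem HAST.ast {c : Cmd Var Val} (h : HAST c) : AST c := by
  induction c with
  | skip | assign | sample => exact fun σ => PMF.tsum_coe _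
  | seq c c' ih ih' =>
    intro σ
    simp only [sem, tsum_push, ih' h.2 _, expect_one, ih h.1 σ]
  | cond b c c' ih ih' =>
    intro σ
    rw [sem]
    split_ifs
    exacts [ih h.1 σ, ih' h.2 σ]
  | loop b c => exact h.2

end Semantics

section Subcouplings

variable {A B : Type*} {μ₁ : A → ℝ≥0∞} {μ₂ : B → ℝ≥0∞} {ν : A × B → ℝ≥0∞}

/-- `ν` is a sub-coupling of `μ₁` and `μ₂`: its marginals are dominated by `μ₁` and `μ₂`.
Unlike couplings, sub-couplings of finite masses form a compact set even when the total mass of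
`ν` is bounded below. -/
def IsSubcoupling (ν : A × B → ℝ≥0∞) (μ₁ : A → ℝ≥0∞) (μ₂ : B → ℝ≥0∞) : Prop :=
  margL ν ≤ μ₁ ∧ margR ν ≤ μ₂

theorem IsCoupling.isSubcoupling (h : IsCoupling ν μ₁ μ₂) : IsSubcoupling ν μ₁ μ₂ :=
  ⟨h.1.le, h.2.le⟩

theorem IsSubcoupling.tsum_le_left (h : IsSubcoupling ν μ₁ μ₂) : ∑' p, ν p ≤ ∑' a, μ₁ a :=
  (tsum_margL ν).symm.trans_le (ENNReal.tsum_le_tsum h.1)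

theorem IsSubcoupling.mono {μ₁' : A → ℝ≥0∞} {μ₂' : B → ℝ≥0∞} (h : IsSubcoupling ν μ₁ μ₂)
    (h₁ : μ₁ ≤ μ₁') (h₂ : μ₂ ≤ μ₂') : IsSubcoupling ν μ₁' μ₂' :=
  ⟨h.1.trans h₁, h.2.trans h₂⟩

theorem IsSubcoupling.tsum_le_sum_product_add (h : IsSubcoupling ν μ₁ μ₂) (F : Finset A)
    (G : Finset B) :
    ∑' p, ν p ≤ ∑ p ∈ F ×ˢ G, ν p + (∑' a : {a // a ∉ F}, μ₁ a + ∑' b : {b // b ∉ G}, μ₂ b) :=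
  calc ∑' p, ν p
      = ∑ a ∈ F, margL ν a + ∑' a : {a // a ∉ F}, margL ν a := by
        rw [← tsum_margL]
        exact (ENNReal.sum_add_tsum_compl F (margL ν)).symm
    _ = ∑ p ∈ F ×ˢ G, ν p + ∑' b : {b // b ∉ G}, ∑ a ∈ F, ν (a, b) +
          ∑' a : {a // a ∉ F}, margL ν a := by
        rw [Summable.tsum_finsetSum fun _ _ => ENNReal.summable, Finset.sum_product,
          ← Finset.sum_add_distrib]
        exact congrArg (· + _) (Finset.sum_congr rfl fun a _ =>
          (ENNReal.sum_add_tsum_compl G fun b => ν (a, b)).symm)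
    _ ≤ ∑ p ∈ F ×ˢ G, ν p + ∑' b : {b // b ∉ G}, μ₂ b + ∑' a : {a // a ∉ F}, μ₁ a := by
        gcongr with b a
        · exact (ENNReal.sum_le_tsum F).trans (h.2 b)
        · exact h.1 a
    _ = _ := by rw [add_assoc, add_comm (∑' b : {b // b ∉ G}, μ₂ b)]

theorem IsSubcoupling.le_tsum_iff (h : IsSubcoupling ν μ₁ μ₂) (hμ₁ : ∑' a, μ₁ a ≠ ∞)
    (hμ₂ : ∑' b, μ₂ b ≠ ∞) {m : ℝ≥0∞} :
    m ≤ ∑' p, ν p ↔ ∀ (F : Finset A) (G : Finset B),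
      m ≤ ∑ p ∈ F ×ˢ G, ν p + (∑' a : {a // a ∉ F}, μ₁ a + ∑' b : {b // b ∉ G}, μ₂ b) := by
  refine ⟨fun hm F G => hm.trans (h.tsum_le_sum_product_add F G), fun hm => ?_⟩
  have tails : Filter.Tendsto
      (fun s : Finset A × Finset B => ∑' p, ν p +
        (∑' a : {a // a ∉ s.1}, μ₁ a + ∑' b : {b // b ∉ s.2}, μ₂ b))
      (Filter.atTop ×ˢ Filter.atTop) (nhds (∑' p, ν p + (0 + 0))) :=
    tendsto_const_nhds.add
      (((ENNReal.tendsto_tsum_compl_atTop_zero hμ₁).comp Filter.tendsto_fst).add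
        ((ENNReal.tendsto_tsum_compl_atTop_zero hμ₂).comp Filter.tendsto_snd))
  rw [add_zero, add_zero] at tails
  exact ge_of_tendsto' tails fun s =>
    (hm s.1 s.2).trans (add_le_add_left (ENNReal.sum_le_tsum _) _)

theorem isClosed_setOf_isSubcoupling_and_le_tsum (hμ₁ : ∑' a, μ₁ a ≠ ∞) (hμ₂ : ∑' b, μ₂ b ≠ ∞)
    (m : ℝ≥0∞) : IsClosed {ν | IsSubcoupling ν μ₁ μ₂ ∧ m ≤ ∑' p, ν p} := by
  have eq_inter : {ν | IsSubcoupling ν μ₁ μ₂ ∧ m ≤ ∑' p, ν p} =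
      (⋂ a, {ν | margL ν a ≤ μ₁ a}) ∩ (⋂ b, {ν | margR ν b ≤ μ₂ b}) ∩
      ⋂ (F : Finset A) (G : Finset B), {ν | m ≤ ∑ p ∈ F ×ˢ G, ν p +
        (∑' a : {a // a ∉ F}, μ₁ a + ∑' b : {b // b ∉ G}, μ₂ b)} := by
    ext ν
    rw [Set.mem_ofPred_eq, and_congr_right fun h => h.le_tsum_iff hμ₁ hμ₂]
    simp only [IsSubcoupling, Pi.le_def, Set.mem_inter_iff, Set.mem_iInter, Set.mem_ofPred_eq]
  rw [eq_inter]
  refine ((isClosed_iInter fun a => ?_).inter (isClosed_iInter fun b => ?_)).inter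
    (isClosed_iInter fun F => isClosed_iInter fun G => isClosed_le continuous_const (by fun_prop))
  · exact (lowerSemicontinuous_tsum fun b =>
      (continuous_apply (a, b)).lowerSemicontinuous).isClosed_preimage _
  · exact (lowerSemicontinuous_tsum fun a =>
      (continuous_apply (a, b)).lowerSemicontinuous).isClosed_preimage _

theorem lowerSemicontinuous_expect (φ : A → ℝ≥0∞) :
    LowerSemicontinuous fun μ : A → ℝ≥0∞ => expect μ φ := by
  refine lowerSemicontinuous_tsum fun a => ?_
  -- Multiplication by `∞` is not continuous on `ℝ≥0∞`, but the truncations of `φ` are finite.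
  have eq_iSup : (fun μ : A → ℝ≥0∞ => μ a * φ a) = fun μ => ⨆ n : ℕ, μ a * min (φ a) n := by
    funext μ
    rw [← ENNReal.mul_iSup, ← inf_iSup_eq, ENNReal.iSup_natCast, inf_top_eq]
  rw [eq_iSup]
  refine lowerSemicontinuous_iSup fun n => Continuous.lowerSemicontinuous ?_
  exact (ENNReal.continuous_mul_const
    (ne_top_of_le_ne_top (ENNReal.natCast_ne_top n) (min_le_right _ _))).comp (continuous_apply a)

theorem eq_of_le_of_tsum_le {f g : A → ℝ≥0∞} (hf : ∑' a, f a ≠ ∞) (hle : f ≤ g)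
    (h : ∑' a, g a ≤ ∑' a, f a) : f = g := by
  by_contra hne
  obtain ⟨a, ha⟩ := Function.ne_iff.1 hne
  exact h.not_gt (ENNReal.tsum_lt_tsum hf hle ((hle a).lt_of_ne ha))

theorem IsSubcoupling.isCoupling (h : IsSubcoupling ν μ₁ μ₂) (hν : ∑' p, ν p ≠ ∞)
    (h₁ : ∑' a, μ₁ a ≤ ∑' p, ν p) (h₂ : ∑' b, μ₂ b ≤ ∑' p, ν p) : IsCoupling ν μ₁ μ₂ :=
  ⟨eq_of_le_of_tsum_le (by rwa [tsum_margL]) h.1 (by rwa [tsum_margL]),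
    eq_of_le_of_tsum_le (by rwa [tsum_margR]) h.2 (by rwa [tsum_margR])⟩

theorem isClosed_setOf_isCoupling (hμ₁ : ∑' a, μ₁ a ≠ ∞) (h : ∑' a, μ₁ a = ∑' b, μ₂ b) :
    IsClosed {ν | IsCoupling ν μ₁ μ₂} := by
  convert isClosed_setOf_isSubcoupling_and_le_tsum hμ₁ (h ▸ hμ₁) (∑' a, μ₁ a) using 1
  ext ν
  exact ⟨fun hν => ⟨hν.isSubcoupling, hν.tsum_left.le⟩, fun hν =>
    hν.1.isCoupling (ne_top_of_le_ne_top hμ₁ hν.1.tsum_le_left) hν.2 (h ▸ hν.2)⟩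

theorem IsCoupling.exists_expect_le_couplingInf (hν : IsCoupling ν μ₁ μ₂)
    (hμ₁ : ∑' a, μ₁ a ≠ ∞) (φ : A × B → ℝ≥0∞) :
    ∃ ν', IsCoupling ν' μ₁ μ₂ ∧ expect ν' φ ≤ couplingInf μ₁ μ₂ φ := by
  have closed := isClosed_setOf_isCoupling hμ₁ (hν.tsum_left.trans hν.tsum_right.symm)
  obtain ⟨ν', hν', hmin⟩ := LowerSemicontinuousOn.exists_isMinOn
    (s := {ν | IsCoupling ν μ₁ μ₂}) ⟨ν, hν⟩ closed.isCompact
    ((lowerSemicontinuous_expect φ).lowerSemicontinuousOn _)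
  exact ⟨ν', hν', le_iInf₂ fun _ h => hmin h⟩

theorem exists_isSubcoupling_iInf {u₁ : ℕ → A → ℝ≥0∞} {u₂ : ℕ → B → ℝ≥0∞} (hu₁ : Antitone u₁)
    (hu₂ : Antitone u₂) (hfin₁ : ∀ n, ∑' a, u₁ n a ≠ ∞) (hfin₂ : ∀ n, ∑' b, u₂ n b ≠ ∞)
    {φ : A × B → ℝ≥0∞} {m r : ℝ≥0∞}
    (h : ∀ n, ∃ ν, (IsSubcoupling ν (u₁ n) (u₂ n) ∧ m ≤ ∑' p, ν p) ∧ expect ν φ ≤ r) :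
    ∃ ν, (IsSubcoupling ν (⨅ n, u₁ n) (⨅ n, u₂ n) ∧ m ≤ ∑' p, ν p) ∧ expect ν φ ≤ r := by
  let S n := {ν | IsSubcoupling ν (u₁ n) (u₂ n) ∧ m ≤ ∑' p, ν p} ∩ {ν | expect ν φ ≤ r}
  have closed n : IsClosed (S n) :=
    (isClosed_setOf_isSubcoupling_and_le_tsum (hfin₁ n) (hfin₂ n) m).inter
      ((lowerSemicontinuous_expect φ).isClosed_preimage r)
  have antitone : Antitone S := fun _ _ hmn _ hν =>
    ⟨⟨hν.1.1.mono (hu₁ hmn) (hu₂ hmn), hν.1.2⟩, hν.2⟩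
  obtain ⟨ν, hν⟩ := IsCompact.nonempty_iInter_of_directed_nonempty_isCompact_isClosed S
    antitone.directed_ge h (fun n => (closed n).isCompact) closed
  rw [Set.mem_iInter] at hν
  exact ⟨ν, ⟨⟨le_iInf fun n => (hν n).1.1.1, le_iInf fun n => (hν n).1.1.2⟩, (hν 0).1.2⟩,
    (hν 0).2⟩

end Subcouplings

section Completion

variable {A B A' B' : Type*}

theorem tsum_option (f : Option A → ℝ≥0∞) : ∑' o, f o = f none + ∑' a, f (some a) := by
  rw [← (Equiv.optionEquivSumPUnit.{0} A).symm.tsum_eq f,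
    ENNReal.summable.tsum_sum ENNReal.summable, add_comm, tsum_fintype]
  simp

theorem tsum_star {μ : A → ℝ≥0∞} (h : IsSubDist μ) : ∑' o, star μ o = 1 :=
  (tsum_option _).trans (tsub_add_cancel_of_le h)

theorem eq_star {μ : A → ℝ≥0∞} {f : Option A → ℝ≥0∞} (h : ∑' o, f o = 1)
    (hsome : ∀ a, f (some a) = μ a) : f = star μ := by
  funext o
  cases o with
  | some a => exact hsome a
  | none =>
    simp only [tsum_option, hsome] at h
    refine ENNReal.eq_sub_of_add_eq ?_ h
    exact ne_top_of_le_ne_top ENNReal.one_ne_top (le_add_self.trans_eq h)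

theorem expect_star (μ : A → ℝ≥0∞) (φ : Option A → ℝ≥0∞) :
    expect (star μ) φ = (1 - ∑' a, μ a) * φ none + expect μ (φ ∘ some) :=
  tsum_option _

theorem expect_starExt (ν : Option A × Option B → ℝ≥0∞) (φ : A × B → ℝ≥0∞) :
    expect ν (starExt φ) = expect (fun p => ν (some p.1, some p.2)) φ := by
  simp only [expect, ENNReal.tsum_prod', tsum_option, starExt, mul_zero, zero_add, tsum_zero]

/-- The extension of a transition kernel to completed distributions, for which the divergent
outcome `none` is absorbing. -/
noncomputable def starKernel (k : A → B → ℝ≥0∞) : Option A → Option B → ℝ≥0∞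
  | none => ⇑(PMF.pure none)
  | some a => star (k a)

theorem tsum_starKernel {k : A → B → ℝ≥0∞} (hk : ∀ a, IsSubDist (k a)) (o : Option A) :
    ∑' o', starKernel k o o' = 1 := by
  cases o with
  | none => exact PMF.tsum_coe _
  | some a => exact tsum_star (hk a)

theorem star_push {k : A → B → ℝ≥0∞} {μ : A → ℝ≥0∞} (hk : ∀ a, IsSubDist (k a))
    (hμ : IsSubDist μ) : star (push k μ) = push (starKernel k) (star μ) := by
  symm
  refine eq_star ?_ fun b => ?_
  · simp only [tsum_push, tsum_starKernel hk, expect_one, tsum_star hμ]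
  · have none_some : starKernel k none (some b) = 0 := by classical simp [starKernel]
    exact (expect_star μ fun o => starKernel k o (some b)).trans (by
      rw [none_some, mul_zero, zero_add]
      rfl)

theorem iInf_star_sup_star_iSup {l : ℕ → A → ℝ≥0∞} (hl : Monotone l) :
    ⨅ n, star (l n) ⊔ star (⨆ n, l n) = star (⨆ n, l n) := by
  refine le_antisymm (fun o => ?_) (le_iInf fun n => le_sup_right)
  rw [iInf_apply]
  cases o with
  | some a => exact iInf_le_of_le 0 (sup_le (le_iSup l 0 a) le_rfl)
  | none =>
    simp only [star, Pi.sup_apply, iSup_apply, tsum_iSup_of_monotone hl,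
      ENNReal.sub_iSup ENNReal.one_ne_top]
    exact iInf_mono fun n => sup_le le_rfl (iInf_le _ n)

theorem antitone_star_sup_star_iSup {l : ℕ → A → ℝ≥0∞} (hl : Monotone l) :
    Antitone fun n => star (l n) ⊔ star (⨆ n, l n) := by
  intro m n hmn o
  cases o with
  | some a => exact sup_le (le_sup_of_le_right (le_iSup l n a)) le_sup_right
  | none => exact sup_le_sup_right (tsub_le_tsub_left (ENNReal.tsum_le_tsum (hl hmn)) 1) _

theorem tsum_star_sup_star_ne_top {μ μ' : A → ℝ≥0∞} (h : IsSubDist μ) (h' : IsSubDist μ') :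
    ∑' o, (star μ ⊔ star μ') o ≠ ∞ := by
  refine ne_top_of_le_ne_top (ENNReal.add_ne_top.2 ⟨ENNReal.one_ne_top, ENNReal.one_ne_top⟩) ?_
  calc ∑' o, (star μ ⊔ star μ') o ≤ ∑' o, (star μ o + star μ' o) :=
        ENNReal.tsum_le_tsum fun o => sup_le le_self_add le_add_self
    _ = 1 + 1 := by rw [ENNReal.tsum_add, tsum_star h, tsum_star h']

theorem exists_isCoupling_star_iSup {l₁ : ℕ → A → ℝ≥0∞} {l₂ : ℕ → B → ℝ≥0∞}
    (hl₁ : Monotone l₁) (hl₂ : Monotone l₂) (h₁ : IsSubDist (⨆ n, l₁ n))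
    (h₂ : IsSubDist (⨆ n, l₂ n)) {φ : Option A × Option B → ℝ≥0∞} {r : ℝ≥0∞}
    (h : ∀ n, ∃ ν, IsCoupling ν (star (l₁ n)) (star (l₂ n)) ∧ expect ν φ ≤ r) :
    ∃ ν, IsCoupling ν (star (⨆ n, l₁ n)) (star (⨆ n, l₂ n)) ∧ expect ν φ ≤ r := by
  -- The masses `star (l n)` are not monotone; their joins with `star (⨆ n, l n)` decrease to it.
  obtain ⟨ν, ⟨hν, mass⟩, hr⟩ := exists_isSubcoupling_iInf (m := 1)
    (antitone_star_sup_star_iSup hl₁) (antitone_star_sup_star_iSup hl₂)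
    (fun n => tsum_star_sup_star_ne_top (h₁.mono (le_iSup l₁ n)) h₁)
    (fun n => tsum_star_sup_star_ne_top (h₂.mono (le_iSup l₂ n)) h₂) fun n => by
      obtain ⟨ν, hν, hr⟩ := h n
      have mass : 1 ≤ ∑' p, ν p := by rw [← hν.tsum_left, tsum_star (h₁.mono (le_iSup l₁ n))]
      exact ⟨ν, ⟨hν.isSubcoupling.mono le_sup_left le_sup_left, mass⟩, hr⟩
  rw [iInf_star_sup_star_iSup hl₁, iInf_star_sup_star_iSup hl₂] at hν
  have finite : ∑' p, ν p ≠ ∞ :=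
    ne_top_of_le_ne_top ENNReal.one_ne_top (hν.tsum_le_left.trans_eq (tsum_star h₁))
  exact ⟨ν, hν.isCoupling finite ((tsum_star h₁).trans_le mass) ((tsum_star h₂).trans_le mass), hr⟩

theorem margL_starExt {ν : A × B → ℝ≥0∞} (h : ∑' p, ν p = 1) :
    margL (starExt ν) = star (margL ν) := by
  refine eq_star ?_ fun a => ?_
  · rw [tsum_margL, ← h, ← expect_one ν]
    simpa only [expect, starExt, one_mul, mul_one] using expect_starExt (fun _ => 1) ν
  · simp only [margL, tsum_option, starExt, zero_add]

theorem starExt_swap (φ : A × B → ℝ≥0∞) : starExt φ ∘ Prod.swap = starExt (φ ∘ Prod.swap) := by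
  funext ⟨o, o'⟩
  cases o <;> cases o' <;> rfl

theorem margR_starExt {ν : A × B → ℝ≥0∞} (h : ∑' p, ν p = 1) :
    margR (starExt ν) = star (margR ν) := by
  have swap : ∑' p, (ν ∘ Prod.swap) p = 1 := ((Equiv.prodComm B A).tsum_eq ν).trans h
  exact (congrArg margL (starExt_swap ν)).trans (margL_starExt swap)

theorem IsCoupling.starExt {ν : A × B → ℝ≥0∞} {μ₁ : A → ℝ≥0∞} {μ₂ : B → ℝ≥0∞}
    (h : IsCoupling ν μ₁ μ₂) (hμ₁ : ∑' a, μ₁ a = 1) :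
    IsCoupling (starExt ν) (star μ₁) (star μ₂) := by
  rw [h.tsum_left] at hμ₁
  rw [← h.1, ← h.2]
  exact ⟨margL_starExt hμ₁, margR_starExt hμ₁⟩

theorem IsCoupling.of_star {ν : Option A × Option B → ℝ≥0∞} {μ₁ : A → ℝ≥0∞} {μ₂ : B → ℝ≥0∞}
    (h : IsCoupling ν (star μ₁) (star μ₂)) (hμ₁ : ∑' a, μ₁ a = 1) (hμ₂ : ∑' b, μ₂ b = 1) :
    IsCoupling (fun p => ν (some p.1, some p.2)) μ₁ μ₂ := by
  have none_left (o : Option B) : ν (none, o) = 0 := by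
    refine nonpos_iff_eq_zero.1 ((le_margL ν (none, o)).trans_eq ?_)
    simp only [h.1, star, hμ₁, tsub_self]
  have none_right (o : Option A) : ν (o, none) = 0 := by
    refine nonpos_iff_eq_zero.1 ((le_margR ν (o, none)).trans_eq ?_)
    simp only [h.2, star, hμ₂, tsub_self]
  refine ⟨funext fun a => (?_ : _ = star μ₁ (some a)), funext fun b => (?_ : _ = star μ₂ (some b))⟩
  · simp only [← h.1, margL, tsum_option, none_right, zero_add]
  · simp only [← h.2, margR, tsum_option, none_left, zero_add]

end Completion

section Guards

variable {A : Type*} {P : A → Prop} {ψ : A → ℝ≥0∞} {a : A}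

theorem guard_of_pos (h : P a) : guard P ψ a = ψ a := if_pos h

theorem guard_of_neg (h : ¬P a) : guard P ψ a = ∞ := if_neg h

theorem le_guard_iff {r : ℝ≥0∞} : r ≤ guard P ψ a ↔ (P a → r ≤ ψ a) := by
  by_cases h : P a <;> simp [guard, h]

end Guards

section KernelValidity

variable {A B A' B' A'' B'' : Type*}

/-- `⋆`-validity of a judgment about arbitrary transition kernels, such as the finite unrollings
of a loop. -/
def KernelValid (ψ : A × B → ℝ≥0∞) (k₁ : A → A' → ℝ≥0∞) (k₂ : B → B' → ℝ≥0∞)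
    (φ : A' × B' → ℝ≥0∞) : Prop :=
  ∀ a b, ∃ ν, IsCoupling ν (star (k₁ a)) (star (k₂ b)) ∧ expect ν (starExt φ) ≤ ψ (a, b)

theorem exists_isCoupling_star_of_expect_le {μ₁ : A → ℝ≥0∞} {μ₂ : B → ℝ≥0∞}
    {φ : A × B → ℝ≥0∞} {r : ℝ≥0∞} (h₁ : IsSubDist μ₁) (h₂ : IsSubDist μ₂)
    (h : (expect μ₁ fun a => expect μ₂ fun b => φ (a, b)) ≤ r) :
    ∃ ν, IsCoupling ν (star μ₁) (star μ₂) ∧ expect ν (starExt φ) ≤ r := by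
  refine ⟨_, isCoupling_prodMass (tsum_star h₁) (tsum_star h₂), le_of_eq_of_le ?_ h⟩
  simp only [expect_prodMass, expect_star, starExt, expect_const, mul_zero, zero_add,
    Function.comp_def]

theorem exists_isCoupling_star_pure {a : A} {b : B} {φ : A × B → ℝ≥0∞} {r : ℝ≥0∞}
    (h : φ (a, b) ≤ r) :
    ∃ ν, IsCoupling ν (star ⇑(PMF.pure a)) (star ⇑(PMF.pure b)) ∧ expect ν (starExt φ) ≤ r :=
  exists_isCoupling_star_of_expect_le (isSubDist_pmf _) (isSubDist_pmf _)
    (by rwa [expect_pure, expect_pure])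

variable {ψ : A × B → ℝ≥0∞} {φ : A' × B' → ℝ≥0∞} {k₁ : A → A' → ℝ≥0∞} {k₂ : B → B' → ℝ≥0∞}

theorem KernelValid.exists_isCoupling_star_push (h : KernelValid ψ k₁ k₂ φ)
    (hk₁ : ∀ a, IsSubDist (k₁ a)) (hk₂ : ∀ b, IsSubDist (k₂ b)) {μ₁ : A → ℝ≥0∞}
    {μ₂ : B → ℝ≥0∞} (h₁ : IsSubDist μ₁) (h₂ : IsSubDist μ₂) {r : ℝ≥0∞}
    (hν : ∃ ν, IsCoupling ν (star μ₁) (star μ₂) ∧ expect ν (starExt ψ) ≤ r) :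
    ∃ ν, IsCoupling ν (star (push k₁ μ₁)) (star (push k₂ μ₂)) ∧ expect ν (starExt φ) ≤ r := by
  obtain ⟨ν, hν, hr⟩ := hν
  have (p : Option A × Option B) : ∃ κ, IsCoupling κ (starKernel k₁ p.1) (starKernel k₂ p.2) ∧
      expect κ (starExt φ) ≤ starExt ψ p := by
    have indep := isCoupling_prodMass (tsum_starKernel hk₁ p.1) (tsum_starKernel hk₂ p.2)
    match p with
    | (some a, some b) => exact h a b
    | (none, _) | (some _, none) =>
      exact ⟨_, indep, by simp [expect_prodMass, starKernel, expect_pure, starExt, expect_const]⟩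
  choose κ hκ hκφ using this
  rw [star_push hk₁ h₁, star_push hk₂ h₂]
  refine ⟨push κ ν, hν.push fun p _ => hκ p, le_trans ?_ hr⟩
  rw [expect_push]
  exact expect_mono le_rfl hκφ

theorem KernelValid.push {l₁ : A' → A'' → ℝ≥0∞} {l₂ : B' → B'' → ℝ≥0∞}
    {χ : A'' × B'' → ℝ≥0∞} (h : KernelValid ψ k₁ k₂ φ) (h' : KernelValid φ l₁ l₂ χ)
    (hk₁ : ∀ a, IsSubDist (k₁ a)) (hk₂ : ∀ b, IsSubDist (k₂ b))
    (hl₁ : ∀ a, IsSubDist (l₁ a)) (hl₂ : ∀ b, IsSubDist (l₂ b)) :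
    KernelValid ψ (fun a => push l₁ (k₁ a)) (fun b => push l₂ (k₂ b)) χ :=
  fun a b => h'.exists_isCoupling_star_push hl₁ hl₂ (hk₁ a) (hk₂ b) (h a b)

theorem KernelValid.swap (h : KernelValid ψ k₁ k₂ φ) :
    KernelValid (ψ ∘ Prod.swap) k₂ k₁ (φ ∘ Prod.swap) := by
  intro b a
  obtain ⟨ν, hν, hle⟩ := h a b
  refine ⟨ν ∘ Prod.swap, ⟨hν.2, hν.1⟩, ?_⟩
  rwa [← starExt_swap, expect_swap]

theorem KernelValid.iSup {k₁ : ℕ → A → A' → ℝ≥0∞} {k₂ : ℕ → B → B' → ℝ≥0∞} (hk₁ : Monotone k₁)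
    (hk₂ : Monotone k₂) (h₁ : ∀ a, IsSubDist (⨆ n, k₁ n a)) (h₂ : ∀ b, IsSubDist (⨆ n, k₂ n b))
    (h : ∀ n, KernelValid ψ (k₁ n) (k₂ n) φ) :
    KernelValid ψ (fun a => ⨆ n, k₁ n a) (fun b => ⨆ n, k₂ n b) φ :=
  fun a b => exists_isCoupling_star_iSup (fun _ _ hmn => hk₁ hmn a) (fun _ _ hmn => hk₂ hmn b)
    (h₁ a) (h₂ b) fun n => h n a b

theorem KernelValid.of_isCoupling (h₁ : ∀ a, ∑' x, k₁ a x = 1)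
    (h : ∀ a b, ∃ ν, IsCoupling ν (k₁ a) (k₂ b) ∧ expect ν φ ≤ ψ (a, b)) :
    KernelValid ψ k₁ k₂ φ := by
  intro a b
  obtain ⟨ν, hν, hle⟩ := h a b
  exact ⟨starExt ν, hν.starExt (h₁ a), (expect_starExt _ φ).trans_le hle⟩

theorem KernelValid.exists_isCoupling (h : KernelValid ψ k₁ k₂ φ) (h₁ : ∀ a, ∑' x, k₁ a x = 1)
    (h₂ : ∀ b, ∑' x, k₂ b x = 1) (a : A) (b : B) :
    ∃ ν, IsCoupling ν (k₁ a) (k₂ b) ∧ expect ν φ ≤ ψ (a, b) := by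
  obtain ⟨ν, hν, hle⟩ := h a b
  exact ⟨_, hν.of_star (h₁ a) (h₂ b), (expect_starExt ν φ).symm.trans_le hle⟩

theorem IsCoupling.exists_replace {ν : Option A × Option B → ℝ≥0∞} {μ₁ : Option A → ℝ≥0∞}
    {μ₂ : Option B → ℝ≥0∞} (hν : IsCoupling ν μ₁ μ₂) {ν' : A × B → ℝ≥0∞}
    (hν' : IsCoupling ν' (margL fun p => ν (some p.1, some p.2))
      (margR fun p => ν (some p.1, some p.2))) :
    ∃ ν'', IsCoupling ν'' μ₁ μ₂ ∧ ∀ a b, ν'' (some a, some b) = ν' (a, b) := by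
  let ν'' : Option A × Option B → ℝ≥0∞
    | (some a, some b) => ν' (a, b)
    | p => ν p
  obtain ⟨rfl, rfl⟩ := hν
  refine ⟨ν'', ⟨funext fun o => ?_, funext fun o => ?_⟩, fun _ _ => rfl⟩
  · cases o with
    | none => rfl
    | some a =>
      simp only [margL, tsum_option]
      exact congrArg (ν (some a, none) + ·) (congrFun hν'.1 a)
  · cases o with
    | none => exact tsum_congr fun o => by cases o <;> rfl
    | some b =>
      simp only [margR, tsum_option]
      exact congrArg (ν (none, some b) + ·) (congrFun hν'.2 b)

theorem KernelValid.conseq {ψ' : A × B → ℝ≥0∞} {φ' : A' × B' → ℝ≥0∞}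
    (h : KernelValid ψ' k₁ k₂ φ') (hk₁ : ∀ a, IsSubDist (k₁ a))
    (himp : ∀ (μ : A × B → ℝ≥0∞) (μ₁ : A' → ℝ≥0∞) (μ₂ : B' → ℝ≥0∞),
      IsSubDist μ → IsSubDist μ₁ → IsSubDist μ₂ →
      couplingInf μ₁ μ₂ φ' ≤ expect μ ψ' → couplingInf μ₁ μ₂ φ ≤ expect μ ψ) :
    KernelValid ψ k₁ k₂ φ := by
  intro a b
  obtain ⟨ν, hν, hle⟩ := h a b
  let proper := fun p : A' × B' => ν (some p.1, some p.2)
  have proper_coupling : IsCoupling proper (margL proper) (margR proper) := ⟨rfl, rfl⟩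
  have mass : ∑' p, proper p ≤ 1 :=
    calc ∑' p, proper p = expect ν (starExt fun _ => 1) := by rw [expect_starExt, expect_one]
      _ ≤ expect ν fun _ => 1 :=
        expect_mono le_rfl fun ⟨o, o'⟩ => by cases o <;> cases o' <;> simp [starExt]
      _ = 1 := by rw [expect_one, ← hν.tsum_left, tsum_star (hk₁ a)]
  have hle' := himp ⇑(PMF.pure (a, b)) (margL proper) (margR proper) (isSubDist_pmf _)
    ((tsum_margL proper).trans_le mass) ((tsum_margR proper).trans_le mass) <| by
      rw [expect_pure]
      exact (iInf₂_le proper proper_coupling).trans ((expect_starExt ν φ').symm.trans_le hle)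
  rw [expect_pure] at hle'
  obtain ⟨ν', hν', hmin⟩ := proper_coupling.exists_expect_le_couplingInf
    (ne_top_of_le_ne_top ENNReal.one_ne_top ((tsum_margL proper).trans_le mass)) φ
  obtain ⟨ν'', hν'', eq⟩ := hν.exists_replace hν'
  refine ⟨ν'', hν'', (expect_starExt ν'' φ).trans_le ?_⟩
  simp only [eq]
  exact hmin.trans hle'

theorem KernelValid.loopApprox {ψ : A × B → ℝ≥0∞} {b₁ : A → Bool} {b₂ : B → Bool}
    {k₁ : A → A → ℝ≥0∞} {k₂ : B → B → ℝ≥0∞} (hk₁ : ∀ a, IsSubDist (k₁ a))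
    (hk₂ : ∀ b, IsSubDist (k₂ b))
    (h : KernelValid (guard (fun p => b₁ p.1 = true ∧ b₂ p.2 = true) ψ) k₁ k₂
      (guard (fun p => b₁ p.1 = b₂ p.2) ψ)) (n : ℕ) :
    KernelValid (guard (fun p => b₁ p.1 = b₂ p.2) ψ) (loopApprox b₁ k₁ n) (loopApprox b₂ k₂ n)
      (guard (fun p => b₁ p.1 = false ∧ b₂ p.2 = false) ψ) := by
  have sub₁ n := isSubDist_loopApprox (b := b₁) hk₁ n
  have sub₂ n := isSubDist_loopApprox (b := b₂) hk₂ n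
  induction n with
  | zero =>
    refine fun a b => exists_isCoupling_star_of_expect_le (sub₁ 0 a) (sub₂ 0 b) ?_
    simp [ERHL.loopApprox, expect]
  | succ n ih =>
    intro a b
    by_cases hb : b₁ a = b₂ b
    · rw [guard_of_pos (by exact hb), ERHL.loopApprox, ERHL.loopApprox, ← hb]
      cases ha : b₁ a
      · exact exists_isCoupling_star_pure (guard_of_pos ⟨ha, hb ▸ ha⟩).le
      · obtain ⟨ν, hν, hle⟩ := h a b
        exact ih.exists_isCoupling_star_push (sub₁ n) (sub₂ n) (hk₁ a) (hk₂ b)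
          ⟨ν, hν, hle.trans_eq (guard_of_pos ⟨ha, hb ▸ ha⟩)⟩
    · rw [guard_of_neg (by exact hb)]
      exact exists_isCoupling_star_of_expect_le (sub₁ _ a) (sub₂ _ b) le_top

theorem KernelValid.loopApproxL {ψ : A × B → ℝ≥0∞} {b₁ : A → Bool} {k₁ : A → A → ℝ≥0∞}
    (hk₁ : ∀ a, IsSubDist (k₁ a))
    (h : KernelValid (guard (fun p => b₁ p.1 = true) ψ) k₁ (fun b => ⇑(PMF.pure b)) ψ) (n : ℕ) :
    KernelValid ψ (ERHL.loopApprox b₁ k₁ n) (fun b => ⇑(PMF.pure b))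
      (guard (fun p => b₁ p.1 = false) ψ) := by
  have sub₁ n := isSubDist_loopApprox (b := b₁) hk₁ n
  induction n with
  | zero =>
    refine fun a b => exists_isCoupling_star_of_expect_le (sub₁ 0 a) (isSubDist_pmf _) ?_
    simp [ERHL.loopApprox, expect]
  | succ n ih =>
    intro a b
    rw [ERHL.loopApprox]
    cases ha : b₁ a
    · exact exists_isCoupling_star_pure (guard_of_pos (by exact ha)).le
    · obtain ⟨ν, hν, hle⟩ := h a b
      simpa only [push_pure_kernel, if_true] using
        ih.exists_isCoupling_star_push (sub₁ n) (fun _ => isSubDist_pmf _) (hk₁ a)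
          (isSubDist_pmf _) ⟨ν, hν, hle.trans_eq (guard_of_pos (by exact ha))⟩

theorem KernelValid.nmodL {f : A → A' → A'} {ψ : A × B → ℝ≥0∞}
    (hf : ∀ a x, k₁ a x ≠ 0 → f a x = x)
    (h : ∀ a b, ∃ ν, IsCoupling ν (star (k₁ a)) (star (k₂ b)) ∧
      expect ν (starExt fun p => φ (f a p.1, p.2)) ≤ ψ (a, b)) :
    KernelValid ψ k₁ k₂ φ := by
  intro a b
  obtain ⟨ν, hν, hle⟩ := h a b
  refine ⟨ν, hν, le_of_eq_of_le (expect_congr fun p hp => ?_) hle⟩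
  match p with
  | (some x, some y) =>
    have : k₁ a x ≠ 0 := fun h0 => hp <| nonpos_iff_eq_zero.1 <|
      (le_margL ν _).trans_eq ((congrFun hν.1 (some x)).trans h0)
    simp only [starExt, hf a x this]
  | (none, _) | (some _, none) => rfl

end KernelValidity

section FiniteDuality

variable {I J : Type*} [Fintype I] [Fintype J]

/-- The Lagrangian of the problem of minimizing the transport cost `∑ x, ν x * c x` over
probability matrices `ν`, with multipliers `y = (α, β)` for the constraints that `ν` has the
marginals `p` and `q`. -/
def lagrangian (p : I → ℝ) (q : J → ℝ) (c : I × J → ℝ) (ν : I × J → ℝ) (y : (I → ℝ) × (J → ℝ)) :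
    ℝ :=
  ∑ x, ν x * (c x + (∑ i, p i * y.1 i + ∑ j, q j * y.2 j) - y.1 x.1 - y.2 x.2)

variable {p : I → ℝ} {q : J → ℝ} {c : I × J → ℝ} {ν : I × J → ℝ} {K : ℝ}

theorem lagrangian_eq (hν : ∑ x, ν x = 1) (y : (I → ℝ) × (J → ℝ)) :
    lagrangian p q c ν y = ∑ x, ν x * c x + ∑ i, (p i - ∑ j, ν (i, j)) * y.1 i +
      ∑ j, (q j - ∑ i, ν (i, j)) * y.2 j := by
  have left : ∑ x, ν x * y.1 x.1 = ∑ i, (∑ j, ν (i, j)) * y.1 i := by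
    simp only [Fintype.sum_prod_type, Finset.sum_mul]
  have right : ∑ x, ν x * y.2 x.2 = ∑ j, (∑ i, ν (i, j)) * y.2 j := by
    simp only [Fintype.sum_prod_type_right, Finset.sum_mul]
  simp only [lagrangian, mul_sub, mul_add, sub_mul, Finset.sum_sub_distrib, Finset.sum_add_distrib,
    ← Finset.sum_mul, hν, left, right]
  ring

theorem exists_lt_lagrangian (hν : ∑ x, ν x = 1)
    (h : (∀ i, ∑ j, ν (i, j) = p i) → (∀ j, ∑ i, ν (i, j) = q j) → K < ∑ x, ν x * c x) :
    ∃ y, K < lagrangian p q c ν y := by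
  classical
  simp only [lagrangian_eq hν]
  set cost := ∑ x, ν x * c x
  by_cases hp : ∀ i, ∑ j, ν (i, j) = p i
  · by_cases hq : ∀ j, ∑ i, ν (i, j) = q j
    · exact ⟨0, by simpa using h hp hq⟩
    · push Not at hq
      obtain ⟨j, hj⟩ := hq
      refine ⟨(0, Pi.single j ((K - cost + 1) / (q j - ∑ i, ν (i, j)))), ?_⟩
      simp only [Pi.single_apply, mul_ite, mul_zero, Finset.sum_ite_eq', Finset.mem_univ, if_true,
        mul_div_cancel₀ _ (sub_ne_zero.2 hj.symm), Pi.zero_apply, Finset.sum_const_zero]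
      linarith
  · push Not at hp
    obtain ⟨i, hi⟩ := hp
    refine ⟨(Pi.single i ((K - cost + 1) / (p i - ∑ j, ν (i, j))), 0), ?_⟩
    simp only [Pi.single_apply, mul_ite, mul_zero, Finset.sum_ite_eq', Finset.mem_univ, if_true,
      mul_div_cancel₀ _ (sub_ne_zero.2 hi.symm), Pi.zero_apply, Finset.sum_const_zero]
    linarith

theorem continuous_lagrangian_left (y : (I → ℝ) × (J → ℝ)) :
    Continuous fun ν => lagrangian p q c ν y := by
  unfold lagrangian
  fun_prop

theorem continuous_lagrangian_right (ν : I × J → ℝ) : Continuous (lagrangian p q c ν) := by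
  unfold lagrangian
  fun_prop

theorem lagrangian_combo_left {a b : ℝ} (ν ν' : I × J → ℝ) (y : (I → ℝ) × (J → ℝ)) :
    lagrangian p q c (a • ν + b • ν') y = a * lagrangian p q c ν y + b * lagrangian p q c ν' y := by
  simp only [lagrangian, Finset.mul_sum, ← Finset.sum_add_distrib, Pi.add_apply, Pi.smul_apply,
    smul_eq_mul]
  exact Finset.sum_congr rfl fun x _ => by ring

theorem sum_mul_combo {a b : ℝ} (r x x' : I → ℝ) :
    ∑ i, r i * (a * x i + b * x' i) = a * ∑ i, r i * x i + b * ∑ i, r i * x' i := by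
  simp only [Finset.mul_sum, ← Finset.sum_add_distrib]
  exact Finset.sum_congr rfl fun i _ => by ring

theorem lagrangian_combo_right {a b : ℝ} (hab : a + b = 1) (ν : I × J → ℝ)
    (y y' : (I → ℝ) × (J → ℝ)) :
    lagrangian p q c ν (a • y + b • y') = a * lagrangian p q c ν y + b * lagrangian p q c ν y' := by
  obtain rfl : b = 1 - a := by linarith
  simp only [lagrangian, Prod.fst_add, Prod.snd_add, Prod.smul_fst, Prod.smul_snd, Pi.add_apply,
    Pi.smul_apply, smul_eq_mul, sum_mul_combo]
  exact (Finset.sum_congr rfl fun x _ => by ring).trans (sum_mul_combo ν _ _)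

theorem exists_forall_lt_lagrangian [Nonempty (I × J)]
    (h : ∀ ν ∈ stdSimplex ℝ (I × J), ∃ y, K < lagrangian p q c ν y) :
    ∃ y, ∀ ν ∈ stdSimplex ℝ (I × J), K < lagrangian p q c ν y := by
  classical
  obtain ⟨s, -, hs, hcover⟩ := (isCompact_stdSimplex ℝ (I × J)).elim_finite_subcover_image
    (b := Set.univ) (c := fun y => {ν | K < lagrangian p q c ν y})
    (fun y _ => isOpen_lt continuous_const (continuous_lagrangian_left y)) fun ν hν => by
      simpa using h ν hν
  have convexLeft y : ConvexOn ℝ (stdSimplex ℝ (I × J)) fun ν => lagrangian p q c ν y :=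
    ⟨convex_stdSimplex ℝ _, fun _ _ _ _ _ _ _ _ _ => (lagrangian_combo_left _ _ _).le⟩
  have concaveRight ν : ConcaveOn ℝ Set.univ (lagrangian p q c ν) :=
    ⟨convex_univ, fun _ _ _ _ _ _ _ _ hab => (lagrangian_combo_right hab _ _ _).ge⟩
  obtain ⟨y, -, hy⟩ := Sion.exists_lt_iInf_of_lt_iInf_of_finite
    ⟨_, single_mem_stdSimplex ℝ (Classical.arbitrary _)⟩
    (isCompact_stdSimplex ℝ (I × J))
    (fun y _ => (continuous_lagrangian_left y).lowerSemicontinuous.lowerSemicontinuousOn _)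
    (fun y _ => (convexLeft y).quasiconvexOn) convex_univ
    (fun ν _ => (continuous_lagrangian_right ν).upperSemicontinuous.upperSemicontinuousOn _)
    (fun ν _ => (concaveRight ν).quasiconcaveOn) (convex_stdSimplex ℝ (I × J)) hs
    (Set.subset_univ s) fun ν hν => by simpa using hcover hν
  exact ⟨y, hy⟩

theorem exists_matrix_of_dual_le (hp : ∑ i, p i = 1)
    (hdual : ∀ (α : I → ℝ) (β : J → ℝ), (∀ i j, α i + β j ≤ c (i, j)) →
      ∑ i, p i * α i + ∑ j, q j * β j ≤ K) :
    ∃ ν : I × J → ℝ, (∀ x, 0 ≤ ν x) ∧ (∀ i, ∑ j, ν (i, j) = p i) ∧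
      (∀ j, ∑ i, ν (i, j) = q j) ∧ ∑ x, ν x * c x ≤ K := by
  classical
  by_contra! hcon
  have : Nonempty I := not_isEmpty_iff.1 fun _ => by simp at hp
  have : Nonempty J := not_isEmpty_iff.1 fun _ => by
    have := hdual (fun _ => K + 1) 0 fun _ => isEmptyElim
    simp only [← Finset.sum_mul, hp, Finset.univ_eq_empty, Finset.sum_empty] at this
    linarith
  obtain ⟨y, hy⟩ := exists_forall_lt_lagrangian (p := p) (q := q) (c := c) (K := K) fun ν hν =>
    exists_lt_lagrangian hν.2 fun h₁ h₂ => hcon ν hν.1 h₁ h₂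
  obtain ⟨ν, hν, hmin⟩ := (isCompact_stdSimplex ℝ (I × J)).exists_isMinOn
    ⟨_, single_mem_stdSimplex ℝ (Classical.arbitrary _)⟩
    (continuous_lagrangian_left (p := p) (q := q) (c := c) y).continuousOn
  set m := lagrangian p q c ν y
  set S := ∑ i, p i * y.1 i + ∑ j, q j * y.2 j with hS
  have feasible (i : I) (j : J) : y.1 i + (m - S) + y.2 j ≤ c (i, j) := by
    have : m ≤ lagrangian p q c (Pi.single (i, j) 1) y := hmin (single_mem_stdSimplex ℝ (i, j))
    simp only [lagrangian, Pi.single_apply, ite_mul, one_mul, zero_mul, Finset.sum_ite_eq',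
      Finset.mem_univ, if_true, ← hS] at this
    linarith
  have := hdual (fun i => y.1 i + (m - S)) y.2 feasible
  simp only [mul_add, Finset.sum_add_distrib, ← Finset.sum_mul, hp] at this
  linarith [hy ν hν]

end FiniteDuality

section Fibers

variable {A B I J : Type*} {μ : A → ℝ≥0∞} {f : A → I}

/-- The image of the mass function `μ` under the function `f`. -/
noncomputable def mapMass (f : A → I) (μ : A → ℝ≥0∞) : I → ℝ≥0∞ :=
  push (fun a => ⇑(PMF.pure (f a))) μ

theorem expect_mapMass (μ : A → ℝ≥0∞) (f : A → I) (φ : I → ℝ≥0∞) :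
    expect (mapMass f μ) φ = expect μ fun a => φ (f a) := by
  simp only [mapMass, expect_push, expect_pure]

theorem tsum_mapMass (μ : A → ℝ≥0∞) (f : A → I) :
    ∑' i, mapMass f μ i = ∑' a, μ a := by
  rw [← expect_one, expect_mapMass, expect_one]

theorem mapMass_ne_top (hμ : ∑' a, μ a ≠ ∞) (i : I) : mapMass f μ i ≠ ∞ :=
  ne_top_of_le_ne_top hμ ((ENNReal.le_tsum i).trans_eq (tsum_mapMass μ f))

theorem le_mapMass (μ : A → ℝ≥0∞) (f : A → I) (a : A) :
    μ a ≤ mapMass f μ (f a) := by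
  simpa [mapMass, push] using ENNReal.le_tsum (f := fun a' => μ a' * PMF.pure (f a') (f a)) a

/-- The conditional distribution of `a` given `f a = i`, where `a` is distributed according to `μ`;
it is `0` if `f a = i` has probability `0`. -/
noncomputable def fiber (f : A → I) (μ : A → ℝ≥0∞) (i : I) : A → ℝ≥0∞ :=
  fun a => μ a * PMF.pure (f a) i / mapMass f μ i

theorem tsum_fiber {i : I} (h0 : mapMass f μ i ≠ 0)
    (hμ : ∑' a, μ a ≠ ∞) : ∑' a, fiber f μ i a = 1 := by
  simp only [fiber, div_eq_mul_inv, ENNReal.tsum_mul_right]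
  exact ENNReal.mul_inv_cancel h0 (mapMass_ne_top hμ i)

theorem apply_eq_of_fiber_ne_zero {i : I} {a : A} (h : fiber f μ i a ≠ 0) : f a = i :=
  (eq_of_pure_ne_zero fun h0 => h (by rw [fiber, h0, mul_zero, ENNReal.zero_div])).symm

theorem push_fiber (hμ : ∑' a, μ a ≠ ∞) :
    push (fiber f μ) (mapMass f μ) = μ := by
  funext a
  set p := mapMass f μ with hp
  have : push (fiber f μ) p a = expect ⇑(PMF.pure (f a)) fun i => μ a * (p i / p i) :=
    tsum_congr fun i => by simp only [fiber, ← hp, div_eq_mul_inv]; ring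
  rw [this, expect_pure]
  have hle : μ a ≤ p (f a) := le_mapMass μ f a
  rcases eq_or_ne (p (f a)) 0 with h0 | h0
  · rw [nonpos_iff_eq_zero.1 (hle.trans_eq h0), zero_mul]
  · rw [ENNReal.div_self h0 (mapMass_ne_top hμ _), mul_one]

theorem IsCoupling.exists_lift {g : B → J} {μ₁ : A → ℝ≥0∞} {μ₂ : B → ℝ≥0∞}
    (hμ₁ : ∑' a, μ₁ a ≠ ∞) (hμ₂ : ∑' b, μ₂ b ≠ ∞) {ν : I × J → ℝ≥0∞}
    (hν : IsCoupling ν (mapMass f μ₁) (mapMass g μ₂)) :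
    ∃ ν', IsCoupling ν' μ₁ μ₂ ∧
      ∀ φ : I × J → ℝ≥0∞, expect ν' (fun p => φ (f p.1, g p.2)) = expect ν φ := by
  let κ : I × J → A × B → ℝ≥0∞ := fun x => prodMass (fiber f μ₁ x.1) (fiber g μ₂ x.2)
  have mass₁ x (hx : ν x ≠ 0) : ∑' a, fiber f μ₁ x.1 a = 1 :=
    tsum_fiber (fun h0 => hx (nonpos_iff_eq_zero.1 ((le_margL ν x).trans_eq (hν.1 ▸ h0)))) hμ₁
  have mass₂ x (hx : ν x ≠ 0) : ∑' b, fiber g μ₂ x.2 b = 1 :=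
    tsum_fiber (fun h0 => hx (nonpos_iff_eq_zero.1 ((le_margR ν x).trans_eq (hν.2 ▸ h0)))) hμ₂
  have hκ x (hx : ν x ≠ 0) : IsCoupling (κ x) (fiber f μ₁ x.1) (fiber g μ₂ x.2) :=
    isCoupling_prodMass (mass₁ x hx) (mass₂ x hx)
  refine ⟨ERHL.push κ ν, ?_, fun φ => ?_⟩
  · simpa only [push_fiber hμ₁, push_fiber hμ₂] using hν.push hκ
  · rw [expect_push]
    refine expect_congr fun x hx => ?_
    calc expect (κ x) (fun p => φ (f p.1, g p.2))
        = expect (fiber f μ₁ x.1) fun _ => expect (fiber g μ₂ x.2) fun _ => φ x := by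
          rw [expect_prodMass]
          refine expect_congr fun a ha => expect_congr fun b hb => ?_
          rw [apply_eq_of_fiber_ne_zero ha, apply_eq_of_fiber_ne_zero hb]
      _ = φ x := by rw [expect_const, expect_const, mass₁ x hx, mass₂ x hx, one_mul, one_mul]

end Fibers

section KantorovichDuality

variable {A B I J : Type*} {μ₁ : A → ℝ≥0∞} {μ₂ : B → ℝ≥0∞} {φ : A × B → ℝ≥0∞} {r : ℝ≥0∞}

theorem ofReal_add_mem_dualitySet {α : A → ℝ} {β : B → ℝ} {N : ℕ} (hα : ∀ a, |α a| ≤ N)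
    (hβ : ∀ b, |β b| ≤ N) (h : ∀ a b, ENNReal.ofReal (α a + β b) ≤ φ (a, b)) :
    (2 * N, fun a => ENNReal.ofReal (α a + N), fun b => ENNReal.ofReal (β b + N)) ∈
      dualitySet φ := by
  have bdd {x : ℝ} (hx : |x| ≤ N) : ENNReal.ofReal (x + N) ≤ ((2 * N : ℝ≥0) : ℝ≥0∞) := by
    refine ENNReal.ofReal_le_of_le_toReal ?_
    simp only [ENNReal.coe_toReal, NNReal.coe_mul, NNReal.coe_ofNat, NNReal.coe_natCast]
    linarith [(abs_le.1 hx).2]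
  refine ⟨⟨_, fun a => bdd (hα a)⟩, ⟨_, fun b => bdd (hβ b)⟩, fun p => ?_⟩
  calc ENNReal.ofReal (α p.1 + N) + ENNReal.ofReal (β p.2 + N)
      = ENNReal.ofReal (α p.1 + β p.2 + 2 * N) := by
        rw [← ENNReal.ofReal_add (by linarith [(abs_le.1 (hα p.1)).1])
          (by linarith [(abs_le.1 (hβ p.2)).1])]
        ring_nf
    _ ≤ ENNReal.ofReal (α p.1 + β p.2) + ENNReal.ofReal (2 * N) := ENNReal.ofReal_add_le
    _ ≤ φ p + (2 * N : ℕ) := by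
        gcongr
        · exact h p.1 p.2
        · simp [ENNReal.ofReal_mul]

theorem expect_ofReal [Fintype I] {μ : I → ℝ≥0∞} (hμ : ∑' i, μ i ≠ ∞) {x : I → ℝ}
    (hx : ∀ i, 0 ≤ x i) :
    expect μ (fun i => ENNReal.ofReal (x i)) = ENNReal.ofReal (∑ i, (μ i).toReal * x i) := by
  rw [expect, tsum_fintype,
    ENNReal.ofReal_sum_of_nonneg fun i _ => mul_nonneg ENNReal.toReal_nonneg (hx i)]
  refine Finset.sum_congr rfl fun i _ => ?_
  rw [ENNReal.ofReal_mul ENNReal.toReal_nonneg,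
    ENNReal.ofReal_toReal (ENNReal.ne_top_of_tsum_ne_top hμ i)]

theorem sum_toReal_eq_one [Fintype I] {μ : I → ℝ≥0∞} (hμ : ∑' i, μ i = 1) :
    ∑ i, (μ i).toReal = 1 := by
  rw [← tsum_fintype (L := .unconditional I), ← ENNReal.tsum_toReal_eq, hμ, ENNReal.toReal_one]
  exact ENNReal.ne_top_of_tsum_ne_top (hμ ▸ ENNReal.one_ne_top)

theorem sum_add_sum_le_of_dual_le [Fintype I] [Fintype J] {μ₁ : I → ℝ≥0∞} {μ₂ : J → ℝ≥0∞}
    {φ : I × J → ℝ≥0∞} (hμ₁ : ∑' i, μ₁ i = 1) (hμ₂ : ∑' j, μ₂ j = 1) (hr : r ≠ ∞)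
    (h : ∀ n φ₁ φ₂, (n, φ₁, φ₂) ∈ dualitySet φ → expect μ₁ φ₁ + expect μ₂ φ₂ ≤ r + (n : ℝ≥0∞))
    {α : I → ℝ} {β : J → ℝ} (hαβ : ∀ i j, ENNReal.ofReal (α i + β j) ≤ φ (i, j)) :
    ∑ i, (μ₁ i).toReal * α i + ∑ j, (μ₂ j).toReal * β j ≤ r.toReal := by
  obtain ⟨N, hN⟩ := exists_nat_ge (‖α‖ ⊔ ‖β‖)
  have hα i : |α i| ≤ N := (norm_le_pi_norm α i).trans (le_sup_left.trans hN)
  have hβ j : |β j| ≤ N := (norm_le_pi_norm β j).trans (le_sup_right.trans hN)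
  have hα0 i : 0 ≤ α i + N := by linarith [(abs_le.1 (hα i)).1]
  have hβ0 j : 0 ≤ β j + N := by linarith [(abs_le.1 (hβ j)).1]
  have := h _ _ _ (ofReal_add_mem_dualitySet hα hβ hαβ)
  rw [expect_ofReal (hμ₁ ▸ ENNReal.one_ne_top) hα0, expect_ofReal (hμ₂ ▸ ENNReal.one_ne_top) hβ0,
    ← ENNReal.ofReal_add (Finset.sum_nonneg fun i _ => mul_nonneg ENNReal.toReal_nonneg (hα0 i))
      (Finset.sum_nonneg fun j _ => mul_nonneg ENNReal.toReal_nonneg (hβ0 j)),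
    ENNReal.ofReal_le_iff_le_toReal (by finiteness),
    ENNReal.toReal_add hr (ENNReal.natCast_ne_top _), ENNReal.toReal_natCast] at this
  simp only [mul_add, Finset.sum_add_distrib, ← Finset.sum_mul, sum_toReal_eq_one hμ₁,
    sum_toReal_eq_one hμ₂, Nat.cast_mul, Nat.cast_ofNat] at this
  linarith

theorem exists_isCoupling_of_dual_le_of_finite [Finite I] [Finite J] {μ₁ : I → ℝ≥0∞}
    {μ₂ : J → ℝ≥0∞} (hμ₁ : ∑' i, μ₁ i = 1) (hμ₂ : ∑' j, μ₂ j = 1) (hr : r ≠ ∞)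
    {φ : I × J → ℝ≥0∞} (hφ : ∀ x, φ x ≠ ∞)
    (h : ∀ n φ₁ φ₂, (n, φ₁, φ₂) ∈ dualitySet φ →
      expect μ₁ φ₁ + expect μ₂ φ₂ ≤ r + (n : ℝ≥0∞)) :
    ∃ ν, IsCoupling ν μ₁ μ₂ ∧ expect ν φ ≤ r := by
  have := Fintype.ofFinite I
  have := Fintype.ofFinite J
  obtain ⟨ν, hν0, hν₁, hν₂, hνφ⟩ := exists_matrix_of_dual_le (c := fun x => (φ x).toReal)
    (q := fun j => (μ₂ j).toReal) (sum_toReal_eq_one hμ₁) fun α β hαβ =>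
      sum_add_sum_le_of_dual_le hμ₁ hμ₂ hr h fun i j => ENNReal.ofReal_le_of_le_toReal (hαβ i j)
  refine ⟨fun x => ENNReal.ofReal (ν x), ⟨funext fun i => ?_, funext fun j => ?_⟩, ?_⟩
  · rw [margL, tsum_fintype, ← ENNReal.ofReal_sum_of_nonneg fun j _ => hν0 _, hν₁,
      ENNReal.ofReal_toReal (ENNReal.ne_top_of_tsum_ne_top (hμ₁ ▸ ENNReal.one_ne_top) i)]
  · rw [margR, tsum_fintype, ← ENNReal.ofReal_sum_of_nonneg fun i _ => hν0 _, hν₂,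
      ENNReal.ofReal_toReal (ENNReal.ne_top_of_tsum_ne_top (hμ₂ ▸ ENNReal.one_ne_top) j)]
  · calc expect (fun x => ENNReal.ofReal (ν x)) φ
        = ENNReal.ofReal (∑ x, ν x * (φ x).toReal) := by
          rw [expect, tsum_fintype, ENNReal.ofReal_sum_of_nonneg fun x _ =>
            mul_nonneg (hν0 x) ENNReal.toReal_nonneg]
          refine Finset.sum_congr rfl fun x _ => ?_
          rw [ENNReal.ofReal_mul (hν0 x), ENNReal.ofReal_toReal (hφ x)]
      _ ≤ r := ENNReal.ofReal_le_of_le_toReal hνφ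

theorem comp_mem_dualitySet {f : A → I} {g : B → J} {χ : I × J → ℝ≥0∞}
    (hχ : ∀ a b, χ (f a, g b) ≤ φ (a, b)) {n : ℕ} {φ₁ : I → ℝ≥0∞} {φ₂ : J → ℝ≥0∞}
    (h : (n, φ₁, φ₂) ∈ dualitySet χ) : (n, φ₁ ∘ f, φ₂ ∘ g) ∈ dualitySet φ := by
  obtain ⟨⟨L₁, hL₁⟩, ⟨L₂, hL₂⟩, hle⟩ := h
  exact ⟨⟨L₁, fun a => hL₁ (f a)⟩, ⟨L₂, fun b => hL₂ (g b)⟩, fun p =>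
    (hle (f p.1, g p.2)).trans (add_le_add_left (hχ p.1 p.2) _)⟩

theorem exists_isCoupling_of_dual_le_of_comp_le [Finite I] [Finite J] (hμ₁ : ∑' a, μ₁ a = 1)
    (hμ₂ : ∑' b, μ₂ b = 1) (hr : r ≠ ∞) {f : A → I} {g : B → J} {χ : I × J → ℝ≥0∞}
    (hfin : ∀ x, χ x ≠ ∞) (hχ : ∀ a b, χ (f a, g b) ≤ φ (a, b))
    (h : ∀ n φ₁ φ₂, (n, φ₁, φ₂) ∈ dualitySet φ →
      expect μ₁ φ₁ + expect μ₂ φ₂ ≤ r + (n : ℝ≥0∞)) :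
    ∃ ν, IsCoupling ν μ₁ μ₂ ∧ expect ν (fun p => χ (f p.1, g p.2)) ≤ r := by
  obtain ⟨ν, hν, hle⟩ := exists_isCoupling_of_dual_le_of_finite (μ₁ := mapMass f μ₁)
    (μ₂ := mapMass g μ₂) ((tsum_mapMass _ _).trans hμ₁) ((tsum_mapMass _ _).trans hμ₂) hr hfin
    fun n φ₁ φ₂ hmem => by
      rw [expect_mapMass, expect_mapMass]
      exact h n _ _ (comp_mem_dualitySet hχ hmem)
  obtain ⟨ν', hν', heq⟩ := IsCoupling.exists_lift (hμ₁ ▸ ENNReal.one_ne_top)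
    (hμ₂ ▸ ENNReal.one_ne_top) hν
  exact ⟨ν', hν', (heq χ).trans_le hle⟩

open Classical in
/-- The quotient map that identifies all points outside the finite set `F`. -/
noncomputable def collapse (F : Finset A) (a : A) : Option F :=
  if h : a ∈ F then some ⟨a, h⟩ else none

theorem starExt_collapse_le (F : Finset A) (G : Finset B) (φ : A × B → ℝ≥0∞) (a : A) (b : B) :
    starExt (fun p : F × G => φ (p.1, p.2)) (collapse F a, collapse G b) ≤ φ (a, b) := by
  by_cases ha : a ∈ F <;> by_cases hb : b ∈ G <;> simp [collapse, starExt, ha, hb]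

theorem starExt_collapse_of_mem {F : Finset A} {G : Finset B} (φ : A × B → ℝ≥0∞) {a : A} {b : B}
    (ha : a ∈ F) (hb : b ∈ G) :
    starExt (fun p : F × G => φ (p.1, p.2)) (collapse F a, collapse G b) = φ (a, b) := by
  simp [collapse, starExt, ha, hb]

theorem exists_isCoupling_sum_min_le_of_dual_le (hμ₁ : ∑' a, μ₁ a = 1) (hμ₂ : ∑' b, μ₂ b = 1)
    (hr : r ≠ ∞)
    (h : ∀ n φ₁ φ₂, (n, φ₁, φ₂) ∈ dualitySet φ →
      expect μ₁ φ₁ + expect μ₂ φ₂ ≤ r + (n : ℝ≥0∞)) (T : Finset (A × B)) (n : ℕ) :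
    ∃ ν, IsCoupling ν μ₁ μ₂ ∧ ∑ p ∈ T, ν p * min (φ p) n ≤ r := by
  classical
  let F := T.image Prod.fst
  let G := T.image Prod.snd
  let ψ : A × B → ℝ≥0∞ := fun p => min (φ p) n
  let χ : Option F × Option G → ℝ≥0∞ := starExt fun p => ψ (p.1, p.2)
  have finite x : χ x ≠ ∞ := by
    match x with
    | (some _, some _) => exact ne_top_of_le_ne_top (ENNReal.natCast_ne_top n) (min_le_right _ _)
    | (none, _) | (some _, none) => exact ENNReal.zero_ne_top
  obtain ⟨ν, hν, hle⟩ := exists_isCoupling_of_dual_le_of_comp_le hμ₁ hμ₂ hr finite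
    (fun a b => (starExt_collapse_le F G ψ a b).trans (min_le_left _ _)) h
  refine ⟨ν, hν, le_trans ?_ hle⟩
  refine (Finset.sum_le_sum fun p hp => ?_).trans (ENNReal.sum_le_tsum T)
  exact (congrArg (ν p * ·) (starExt_collapse_of_mem ψ (Finset.mem_image_of_mem _ hp)
    (Finset.mem_image_of_mem _ hp))).ge

theorem expect_le_of_forall_sum_min_le {μ φ : A → ℝ≥0∞}
    (h : ∀ (T : Finset A) (n : ℕ), ∑ a ∈ T, μ a * min (φ a) n ≤ r) : expect μ φ ≤ r := by
  have mono : Monotone fun (n : ℕ) a => min (φ a) n :=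
    fun m n hmn a => min_le_min_left _ (Nat.cast_le.2 hmn)
  calc expect μ φ = expect μ fun a => ⨆ n : ℕ, min (φ a) n := by
        simp only [← inf_iSup_eq, ENNReal.iSup_natCast, inf_top_eq]
    _ = ⨆ n : ℕ, expect μ fun a => min (φ a) n := expect_iSup_of_monotone μ mono
    _ ≤ r := iSup_le fun n => ENNReal.tsum_eq_iSup_sum.trans_le (iSup_le fun T => h T n)

theorem exists_isCoupling_of_forall_sum_min_le (hμ₁ : ∑' a, μ₁ a ≠ ∞)
    (hμ : ∑' a, μ₁ a = ∑' b, μ₂ b)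
    (h : ∀ (T : Finset (A × B)) (n : ℕ), ∃ ν, IsCoupling ν μ₁ μ₂ ∧
      ∑ p ∈ T, ν p * min (φ p) n ≤ r) :
    ∃ ν, IsCoupling ν μ₁ μ₂ ∧ expect ν φ ≤ r := by
  classical
  let S : Finset (A × B) × ℕ → Set (A × B → ℝ≥0∞) := fun t =>
    {ν | IsCoupling ν μ₁ μ₂} ∩ {ν | ∑ p ∈ t.1, ν p * min (φ p) t.2 ≤ r}
  have closed t : IsClosed (S t) := by
    refine (isClosed_setOf_isCoupling hμ₁ hμ).inter
      (isClosed_le (continuous_finsetSum _ fun p _ => ?_) continuous_const)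
    exact (ENNReal.continuous_mul_const (ne_top_of_le_ne_top (ENNReal.natCast_ne_top _)
      (min_le_right _ _))).comp (continuous_apply p)
  have antitone : Antitone S := fun t t' htt' ν hν => ⟨hν.1,
    calc ∑ p ∈ t.1, ν p * min (φ p) t.2 ≤ ∑ p ∈ t.1, ν p * min (φ p) t'.2 := by
          gcongr
          exact htt'.2
      _ ≤ ∑ p ∈ t'.1, ν p * min (φ p) t'.2 := Finset.sum_le_sum_of_subset htt'.1
      _ ≤ r := hν.2⟩
  obtain ⟨ν, hν⟩ := IsCompact.nonempty_iInter_of_directed_nonempty_isCompact_isClosed S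
    antitone.directed_ge (fun t => h t.1 t.2) (fun t => (closed t).isCompact) closed
  rw [Set.mem_iInter] at hν
  exact ⟨ν, (hν (∅, 0)).1, expect_le_of_forall_sum_min_le fun T n => (hν (T, n)).2⟩

theorem exists_isCoupling_of_dual_le (hμ₁ : ∑' a, μ₁ a = 1) (hμ₂ : ∑' b, μ₂ b = 1)
    (h : ∀ n φ₁ φ₂, (n, φ₁, φ₂) ∈ dualitySet φ →
      expect μ₁ φ₁ + expect μ₂ φ₂ ≤ r + (n : ℝ≥0∞)) :
    ∃ ν, IsCoupling ν μ₁ μ₂ ∧ expect ν φ ≤ r := by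
  rcases eq_or_ne r ∞ with rfl | hr
  · exact ⟨_, isCoupling_prodMass hμ₁ hμ₂, le_top⟩
  · exact exists_isCoupling_of_forall_sum_min_le (hμ₁ ▸ ENNReal.one_ne_top) (hμ₁.trans hμ₂.symm)
      (exists_isCoupling_sum_min_le_of_dual_le hμ₁ hμ₂ hr h)

end KantorovichDuality

section Soundness

variable {A B A' B' : Type*} {ψ : A × B → ℝ≥0∞} {φ : A' × B' → ℝ≥0∞} {b₁ : A → Bool}
  {b₂ : B → Bool} {k₁ k₁' : A → A' → ℝ≥0∞} {k₂ k₂' : B → B' → ℝ≥0∞}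

theorem KernelValid.ite (h₁ : ∀ a, IsSubDist (if b₁ a then k₁ a else k₁' a))
    (h₂ : ∀ b, IsSubDist (if b₂ b then k₂ b else k₂' b))
    (h : KernelValid (guard (fun p => b₁ p.1 = true ∧ b₂ p.2 = true) ψ) k₁ k₂ φ)
    (h' : KernelValid (guard (fun p => b₁ p.1 = false ∧ b₂ p.2 = false) ψ) k₁' k₂' φ) :
    KernelValid (guard (fun p => b₁ p.1 = b₂ p.2) ψ) (fun a => if b₁ a then k₁ a else k₁' a)
      (fun b => if b₂ b then k₂ b else k₂' b) φ := by
  intro a b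
  by_cases hb : b₁ a = b₂ b
  · rw [guard_of_pos (by exact hb)]
    cases ha : b₁ a
    · simpa [← hb, ha, guard] using h' a b
    · simpa [← hb, ha, guard] using h a b
  · rw [guard_of_neg (by exact hb)]
    exact exists_isCoupling_star_of_expect_le (h₁ a) (h₂ b) le_top

theorem KernelValid.iteL (h : KernelValid (guard (fun p => b₁ p.1 = true) ψ) k₁ k₂ φ)
    (h' : KernelValid (guard (fun p => b₁ p.1 = false) ψ) k₁' k₂ φ) :
    KernelValid ψ (fun a => if b₁ a then k₁ a else k₁' a) k₂ φ := by
  intro a b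
  cases ha : b₁ a
  · simpa [ha, guard] using h' a b
  · simpa [ha, guard] using h a b

theorem KernelValid.of_dual (hk₁ : ∀ a, ∑' x, k₁ a x = 1) (hk₂ : ∀ b, ∑' x, k₂ b x = 1)
    (h : ∀ n φ₁ φ₂, (n, φ₁, φ₂) ∈ dualitySet φ →
      KernelValid (fun p => ψ p + (n : ℝ≥0∞)) k₁ k₂ (split φ₁ φ₂)) : KernelValid ψ k₁ k₂ φ :=
  .of_isCoupling hk₁ fun a b => exists_isCoupling_of_dual_le (hk₁ a) (hk₂ b)
    fun n φ₁ φ₂ hmem => by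
      obtain ⟨ν, hν, hle⟩ := (h n φ₁ φ₂ hmem).exists_isCoupling hk₁ hk₂ a b
      rwa [hν.expect_split] at hle

variable {Var₁ Var₂ Val : Type*} [DecidableEq Var₁] [DecidableEq Var₂]
  {c₁ : Cmd Var₁ Val} {c₂ : Cmd Var₂ Val}

theorem kernelValid_sample {ψ φ : Assn Var₁ Var₂ Val} {x₁ : Var₁} {x₂ : Var₂}
    {d₁ : State Var₁ Val → PMF Val} {d₂ : State Var₂ Val → PMF Val}
    (h : ∀ σ₁ σ₂, ∃ ν, IsCoupling ν ⇑(d₁ σ₁) ⇑(d₂ σ₂) ∧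
      expect ν (fun v => φ (Function.update σ₁ x₁ v.1, Function.update σ₂ x₂ v.2))
        ≤ ψ (σ₁, σ₂)) :
    KernelValid ψ (sem (.sample x₁ d₁)) (sem (.sample x₂ d₂)) φ := by
  refine .of_isCoupling (fun σ => PMF.tsum_coe _) fun σ₁ σ₂ => ?_
  obtain ⟨ν, hν, hle⟩ := h σ₁ σ₂
  let update (v : Val × Val) := (Function.update σ₁ x₁ v.1, Function.update σ₂ x₂ v.2)
  refine ⟨push (fun v => ⇑(PMF.pure (update v))) ν, ?_, ?_⟩
  · rw [sem_sample, sem_sample]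
    exact hν.push fun v _ => ⟨margL_pure _, margR_pure _⟩
  · simpa only [expect_push, expect_pure] using hle

theorem kernelValid_loop {ψ : Assn Var₁ Var₂ Val} {b₁ : State Var₁ Val → Bool}
    {b₂ : State Var₂ Val → Bool}
    (h : KernelValid (guard (fun p => b₁ p.1 = true ∧ b₂ p.2 = true) ψ) (sem c₁) (sem c₂)
      (guard (fun p => b₁ p.1 = b₂ p.2) ψ)) :
    KernelValid (guard (fun p => b₁ p.1 = b₂ p.2) ψ) (sem (.loop b₁ c₁)) (sem (.loop b₂ c₂))
      (guard (fun p => b₁ p.1 = false ∧ b₂ p.2 = false) ψ) := by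
  have sub₁ := isSubDist_sem (.loop b₁ c₁)
  have sub₂ := isSubDist_sem (.loop b₂ c₂)
  simp only [funext (sem_loop _ _)] at sub₁ sub₂ ⊢
  exact KernelValid.iSup (loopApprox_mono b₁ _) (loopApprox_mono b₂ _) sub₁ sub₂
    (h.loopApprox (isSubDist_sem c₁) (isSubDist_sem c₂))

theorem kernelValid_loopL {ψ : Assn Var₁ Var₂ Val} {b₁ : State Var₁ Val → Bool}
    (h : KernelValid (guard (fun p => b₁ p.1 = true) ψ) (sem c₁) (sem .skip) ψ) :
    KernelValid ψ (sem (.loop b₁ c₁)) (sem .skip) (guard (fun p => b₁ p.1 = false) ψ) := by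
  have sub₁ := isSubDist_sem (.loop b₁ c₁)
  have skip_eq : (fun σ => ⨆ _ : ℕ, sem .skip σ) = sem (.skip : Cmd Var₂ Val) :=
    funext fun σ => iSup_const
  rw [← skip_eq]
  simp only [funext (sem_loop _ _)] at sub₁ ⊢
  exact KernelValid.iSup (loopApprox_mono b₁ _) monotone_const sub₁
    (fun σ => by simpa only [iSup_const] using isSubDist_sem .skip σ)
    (h.loopApproxL (isSubDist_sem c₁))

theorem kernelValid_sampleL (ψ : Assn Var₁ Var₂ Val) (x₁ : Var₁)
    (d₁ : State Var₁ Val → PMF Val) :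
    KernelValid (fun p => expect ⇑(d₁ p.1) fun v => ψ (Function.update p.1 x₁ v, p.2))
      (sem (.sample x₁ d₁)) (sem .skip) ψ := by
  refine fun σ₁ σ₂ => exists_isCoupling_star_of_expect_le (isSubDist_sem _ σ₁)
    (isSubDist_sem _ σ₂) ?_
  simp only [sem_sample, expect_push]
  simp only [sem, expect_pure, le_refl]

theorem kernelValid_nmodL {ψ φ : Assn Var₁ Var₂ Val} {x₁ : Var₁} (hx : x₁ ∉ modVars c₁)
    (h : ∀ v, KernelValid (guard (fun p : State Var₁ Val × State Var₂ Val => p.1 x₁ = v) ψ)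
      (sem c₁) (sem c₂)
      fun p => φ (Function.update p.1 x₁ v, p.2)) :
    KernelValid ψ (sem c₁) (sem c₂) φ := by
  refine .nmodL (f := fun σ τ => Function.update τ x₁ (σ x₁)) (fun σ τ hτ => ?_) fun σ₁ σ₂ => ?_
  · rw [← apply_eq_of_sem_ne_zero hx hτ, Function.update_eq_self]
  · obtain ⟨ν, hν, hle⟩ := h (σ₁ x₁) σ₁ σ₂
    exact ⟨ν, hν, hle.trans_eq (guard_of_pos rfl)⟩

theorem Derivable.kernelValid {strict : Prop} {ψ φ : Assn Var₁ Var₂ Val}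
    (h : Derivable strict ψ c₁ c₂ φ) : KernelValid ψ (sem c₁) (sem c₂) φ := by
  induction h with
  | skip | assign | assignL | assignR => exact fun _ _ => exists_isCoupling_star_pure le_rfl
  | seq _ _ ih ih' =>
    exact ih.push ih' (isSubDist_sem _) (isSubDist_sem _) (isSubDist_sem _) (isSubDist_sem _)
  | cond b₁ b₂ _ _ ih ih' =>
    exact .ite (isSubDist_sem (.cond b₁ _ _)) (isSubDist_sem (.cond b₂ _ _)) ih ih'
  | loop _ _ _ ih => exact kernelValid_loop ih
  | sample _ _ _ _ h => exact kernelValid_sample h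
  | sampleL => exact kernelValid_sampleL _ _ _
  | sampleR ψ => exact (kernelValid_sampleL (ψ ∘ Prod.swap) _ _).swap
  | condL _ _ _ ih ih' => exact ih.iteL ih'
  | condR _ _ _ ih ih' => exact (ih.swap.iteL ih'.swap).swap
  | loopL _ _ _ ih => exact kernelValid_loopL ih
  | loopR _ _ _ ih => exact (kernelValid_loopL ih.swap).swap
  | skipEquiv h₁ h₂ _ ih => rwa [← h₁.sem_eq, ← h₂.sem_eq]
  | conseq _ himp ih => exact ih.conseq (isSubDist_sem _) himp
  | nmodL _ hx _ ih => exact kernelValid_nmodL hx ih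
  | @nmodR ψ φ _ _ _ hx _ ih =>
    exact (kernelValid_nmodL (ψ := ψ ∘ Prod.swap) (φ := φ ∘ Prod.swap) hx fun v =>
      (ih v).swap).swap
  | unboundedDuality h₁ h₂ _ ih => exact .of_dual h₁ h₂ ih

end Soundness

section Completeness

variable {Var₁ Var₂ Val : Type*} [DecidableEq Var₁] [DecidableEq Var₂] {strict : Prop}
  {ψ φ : Assn Var₁ Var₂ Val} {c₁ : Cmd Var₁ Val} {c₂ : Cmd Var₂ Val}

theorem Derivable.weaken {ψ' φ' : Assn Var₁ Var₂ Val} (h : Derivable strict ψ' c₁ c₂ φ')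
    (hψ : ψ' ≤ ψ) (hφ : φ ≤ φ') : Derivable strict ψ c₁ c₂ φ :=
  .conseq h fun _ _ _ _ _ _ hle =>
    ((iInf₂_mono fun _ _ => expect_mono le_rfl hφ).trans hle).trans (expect_mono le_rfl hψ)

theorem derivable_expectL (c : Cmd Var₁ Val) (hc : strict → HAST c) (φ : Assn Var₁ Var₂ Val) :
    Derivable strict (fun p => expect (sem c p.1) fun τ => φ (τ, p.2)) c .skip φ := by
  induction c generalizing φ with
  | skip =>
    simp only [sem, expect_pure]
    exact .skip φ
  | assign x e =>
    simp only [sem, expect_pure]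
    exact .assignL φ x e
  | sample x d =>
    simp only [sem_sample, expect_push, expect_pure]
    exact .sampleL φ x d
  | seq c c' ih ih' =>
    refine .skipEquiv (.refl _) (.skip_seq .skip) (.seq ?_ (ih' (fun h => (hc h).2) φ))
    simp only [sem, expect_push]
    exact ih (fun h => (hc h).1) fun p => expect (sem c' p.1) fun τ => φ (τ, p.2)
  | cond b c c' ih ih' =>
    refine .condL b ((ih (fun h => (hc h).1) φ).weaken (fun p => ?_) le_rfl)
      ((ih' (fun h => (hc h).2) φ).weaken (fun p => ?_) le_rfl)
    all_goals
      refine le_guard_iff.2 fun hb => ?_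
      simp [sem, hb]
  | loop b c ih =>
    refine (Derivable.loopL b (fun h => (hc h).2) ((ih (fun h => (hc h).1) _).weaken
      (fun p => ?_) le_rfl)).weaken le_rfl fun p => ?_
    · refine le_guard_iff.2 fun hb => ?_
      conv_rhs => rw [sem_loop_unfold, if_pos hb, expect_push]
    · refine le_guard_iff.2 fun hb => ?_
      rw [sem_loop_unfold]
      simp [hb, expect_pure]

theorem derivable_expectR (c : Cmd Var₂ Val) (hc : strict → HAST c) (φ : Assn Var₁ Var₂ Val) :
    Derivable strict (fun p => expect (sem c p.2) fun τ => φ (p.1, τ)) .skip c φ := by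
  induction c generalizing φ with
  | skip =>
    simp only [sem, expect_pure]
    exact .skip φ
  | assign x e =>
    simp only [sem, expect_pure]
    exact .assignR φ x e
  | sample x d =>
    simp only [sem_sample, expect_push, expect_pure]
    exact .sampleR φ x d
  | seq c c' ih ih' =>
    refine .skipEquiv (.skip_seq .skip) (.refl _) (.seq ?_ (ih' (fun h => (hc h).2) φ))
    simp only [sem, expect_push]
    exact ih (fun h => (hc h).1) fun p => expect (sem c' p.2) fun τ => φ (p.1, τ)
  | cond b c c' ih ih' =>
    refine .condR b ((ih (fun h => (hc h).1) φ).weaken (fun p => ?_) le_rfl)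
      ((ih' (fun h => (hc h).2) φ).weaken (fun p => ?_) le_rfl)
    all_goals
      refine le_guard_iff.2 fun hb => ?_
      simp [sem, hb]
  | loop b c ih =>
    refine (Derivable.loopR b (fun h => (hc h).2) ((ih (fun h => (hc h).1) _).weaken
      (fun p => ?_) le_rfl)).weaken le_rfl fun p => ?_
    · refine le_guard_iff.2 fun hb => ?_
      conv_rhs => rw [sem_loop_unfold, if_pos hb, expect_push]
    · refine le_guard_iff.2 fun hb => ?_
      rw [sem_loop_unfold]
      simp [hb, expect_pure]

theorem derivable_split (h₁ : AST c₁) (h₂ : AST c₂) (hc₁ : strict → HAST c₁)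
    (hc₂ : strict → HAST c₂) (φ₁ : State Var₁ Val → ℝ≥0∞) (φ₂ : State Var₂ Val → ℝ≥0∞) :
    Derivable strict (fun p => expect (sem c₁ p.1) φ₁ + expect (sem c₂ p.2) φ₂) c₁ c₂
      (split φ₁ φ₂) := by
  -- Up to `≡`, run `c₁` against `skip` first and `skip` against `c₂` afterwards.
  refine .skipEquiv (.seq_skip c₁) (.skip_seq c₂) ?_
  convert Derivable.seq (derivable_expectL c₁ hc₁ _) (derivable_expectR c₂ hc₂ (split φ₁ φ₂))
  simp only [split, expect_add, expect_const, h₁ _, h₂ _, one_mul]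

theorem KernelValid.derivable (h₁ : AST c₁) (h₂ : AST c₂) (hc₁ : strict → HAST c₁)
    (hc₂ : strict → HAST c₂) (h : KernelValid ψ (sem c₁) (sem c₂) φ) :
    Derivable strict ψ c₁ c₂ φ := by
  refine .unboundedDuality h₁ h₂ fun n φ₁ φ₂ hmem => ?_
  refine (derivable_split h₁ h₂ hc₁ hc₂ φ₁ φ₂).weaken (fun p => ?_) le_rfl
  obtain ⟨ν, hν, hle⟩ := h.exists_isCoupling h₁ h₂ p.1 p.2
  calc expect (sem c₁ p.1) φ₁ + expect (sem c₂ p.2) φ₂ = expect ν (split φ₁ φ₂) :=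
        (hν.expect_split φ₁ φ₂).symm
    _ ≤ expect ν fun x => φ x + n := expect_mono le_rfl hmem.2.2
    _ = expect ν φ + n := by rw [expect_add, expect_const, ← hν.tsum_left, h₁, one_mul]
    _ ≤ ψ p + n := add_le_add_left hle _

end Completeness

section Validity

variable {Var₁ Var₂ Val : Type*} [DecidableEq Var₁] [DecidableEq Var₂]
  {ψ φ : Assn Var₁ Var₂ Val} {c₁ : Cmd Var₁ Val} {c₂ : Cmd Var₂ Val}

theorem starValid_iff_forall_exists_isCoupling (h₁ : AST c₁) (h₂ : AST c₂) :
    StarValid ψ c₁ c₂ φ ↔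
      ∀ σ₁ σ₂, ∃ ν, IsCoupling ν (sem c₁ σ₁) (sem c₂ σ₂) ∧ expect ν φ ≤ ψ (σ₁, σ₂) :=
  ⟨fun h => KernelValid.exists_isCoupling h h₁ h₂, KernelValid.of_isCoupling h₁⟩

theorem valid_iff_forall_exists_isCoupling :
    Valid ψ c₁ c₂ φ ↔
      ∀ σ₁ σ₂, ∃ ν, IsCoupling ν (sem c₁ σ₁) (sem c₂ σ₂) ∧ expect ν φ ≤ ψ (σ₁, σ₂) := by
  constructor
  · intro h σ₁ σ₂
    obtain ⟨ν, -, hν, hle⟩ := h ⇑(PMF.pure (σ₁, σ₂)) (isSubDist_pmf _)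
    rw [margL_pure, margR_pure, run, run, push_pure, push_pure] at hν
    exact ⟨ν, hν, (expect_pure _ ψ) ▸ hle⟩
  · intro h μ hμ
    choose κ hκ hle using h
    have coupling : IsCoupling (push (fun p => κ p.1 p.2) μ) (run c₁ (margL μ))
        (run c₂ (margR μ)) :=
      IsCoupling.push ⟨rfl, rfl⟩ fun p _ => hκ p.1 p.2
    refine ⟨_, hμ.push fun p => ?_, coupling, ?_⟩
    · exact (hκ p.1 p.2).tsum_left.symm.trans_le (isSubDist_sem c₁ p.1)
    · rw [expect_push]
      exact expect_mono le_rfl fun p => hle p.1 p.2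

end Validity

end ERHL

theorem mainTheorem5_general {Var₁ Var₂ Val : Type*} [DecidableEq Var₁] [DecidableEq Var₂]
    {strict : Prop} {c₁ : ERHL.Cmd Var₁ Val} {c₂ : ERHL.Cmd Var₂ Val} (h₁ : ERHL.AST c₁)
    (h₂ : ERHL.AST c₂) (hc₁ : strict → ERHL.HAST c₁) (hc₂ : strict → ERHL.HAST c₂)
    (ψ φ : ERHL.Assn Var₁ Var₂ Val) :
    (ERHL.Derivable strict ψ c₁ c₂ φ ↔ ERHL.StarValid ψ c₁ c₂ φ) ∧
      (ERHL.Derivable strict ψ c₁ c₂ φ ↔ ERHL.Valid ψ c₁ c₂ φ) := by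
  have derivable_iff : ERHL.Derivable strict ψ c₁ c₂ φ ↔ ERHL.StarValid ψ c₁ c₂ φ :=
    ⟨ERHL.Derivable.kernelValid, ERHL.KernelValid.derivable h₁ h₂ hc₁ hc₂⟩
  have starValid_iff : ERHL.StarValid ψ c₁ c₂ φ ↔ ERHL.Valid ψ c₁ c₂ φ :=
    (ERHL.starValid_iff_forall_exists_isCoupling h₁ h₂).trans
      ERHL.valid_iff_forall_exists_isCoupling.symm
  exact ⟨derivable_iff, derivable_iff.trans starValid_iff⟩

theorem mainTheorem5 {Var₁ Var₂ Val : Type*} [DecidableEq Var₁] [DecidableEq Var₂]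
    [Finite Var₁] [Finite Var₂] [Countable Val]
    (c₁ : ERHL.Cmd Var₁ Val) (c₂ : ERHL.Cmd Var₂ Val) :
    (ERHL.AST c₁ → ERHL.AST c₂ → ∀ ψ φ : ERHL.Assn Var₁ Var₂ Val,
      (ERHL.Derivable False ψ c₁ c₂ φ ↔ ERHL.StarValid ψ c₁ c₂ φ) ∧
      (ERHL.Derivable False ψ c₁ c₂ φ ↔ ERHL.Valid ψ c₁ c₂ φ)) ∧
    (ERHL.HAST c₁ → ERHL.HAST c₂ → ∀ ψ φ : ERHL.Assn Var₁ Var₂ Val,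
      (ERHL.Derivable True ψ c₁ c₂ φ ↔ ERHL.Valid ψ c₁ c₂ φ)) :=
  ⟨fun h₁ h₂ => mainTheorem5_general h₁ h₂ False.elim False.elim,
    fun h₁ h₂ ψ φ => (mainTheorem5_general h₁.ast h₂.ast (fun _ => h₁) (fun _ => h₂) ψ φ).2⟩
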